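/- **Setting.** Let $d\in\{2,3\}$ and let $\Omega\subset\mathbb R^d$ be a bounded connected open set with Lipschitz boundary $\Gamma$ and (a.e. defined) unit outward normal $n$. Let $b$ be a vector field that is $C^\infty$ in $\Omega$ and continuous on $\overline\Omega$, with $|b|=1$ in $\Omega$, and let $\Gamma_D=\{x\in\Gamma : b(x)\cdot n(x)=0\}$ have nonempty interior relative to $\Gamma$. Let $A_\parallel$ (scalar) and $A_\perp$ ($d\times d$ matrix) be measurable coefficients on $\Omega$ such that, for some constants $0<A_0\le A_1$ and a.e. $x\in\Omega$, $A_0\le A_\parallel(x)\le A_1$ and $A_0|v|^2\le v^tA_\perp(x)v\le A_1|v|^2$ for all $v\in\mathbb R^d$ with $v\cdot b(x)=0$. Put $A=(b\otimes b)A_\parallel(b\otimes b)+(Id-b\otimes b)A_\perp(Id-b\otimes b)$ and assume that $A(x)$ is symmetric for a.e. $x$. Let $\mathcal V=\{v\in H^1(\Omega): v|_{\Gamma_D}=0\}$, $\nabla_\parallel u=(b\cdot\nabla u)\,b$, $$a(u,v)=\int_\Omega A\nabla u\cdot\nabla v,\quad a_\parallel(u,v)=\int_\Omega A_\parallel\nabla_\parallel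 u\cdot\nabla_\parallel v,\quad (u,v)=\int_\Omega uv,\quad |u|_{\mathcal V}=a(u,u)^{1/2},\quad |u|_\parallel=a_\parallel(u,u)^{1/2}.$$ Let $\mathcal V'$ be the dual of $(\mathcal V,|\cdot|_{\mathcal V})$, with $\|f\|_{\mathcal V'}=\sup_{v\in\mathcal V}f(v)/|v|_{\mathcal V}$. Let $V_h\subset\mathcal V$ be a finite-dimensional subspace (for example a $\mathbb P_k$ or $\mathbb Q_k$ finite element space on a mesh), $G_h=\{v\in V_h:\nabla_\parallel v=0\}$, and $A_h$ the $L^2$-orthogonal complement of $G_h$ in $V_h$. Put $|\xi|_{*h}=\sup_{v\in V_h}a_\parallel(\xi,v)/|v|_{\mathcal V}$ (with $0/0=0$ in both suprema) and $$\|u,\xi\|_{X_{\varepsilon,\sigma,h}}=\big(|u|_{\mathcal V}^2+|\xi|_{*h}^2+\varepsilon|\xi|_\parallel^2+\sigma\|\xi\|_{L^2}^2\big)^{1/2}.$$ For $f\in\mathcal V'$ and $W_h\in\{V_h,A_h\}$ consider the problem: find $(u,\xi)\in V_h\times W_h$ with $$a(u,v)+(1-\varepsilon)a_\parallel(\xi,v)=f(v)\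 \ \forall v\in V_h,\qquad a_\parallel(u,w)-\varepsilon a_\parallel(\xi,w)-\sigma(\xi,w)=0\ \ \forall w\in W_h. \tag{$S_{W_h}$}$$ **Theorem.** There is an absolute constant $\beta>0$ (in particular independent of the data, of $V_h$, $\varepsilon$ and $\sigma$) such that for all data as above and all $f\in\mathcal V'$: 1. For all $\varepsilon\ge0$ and $\sigma>0$ the stabilized discrete scheme $(S_{V_h})$ has a unique solution $(u_h^{\varepsilon,\sigma},\xi_h^{\varepsilon,\sigma})\in V_h\times V_h$. It satisfies $\xi_h^{\varepsilon,\sigma}\in A_h$ and, if moreover $\varepsilon\le1$, $$\|u_h^{\varepsilon,\sigma},\xi_h^{\varepsilon,\sigma}\|_{X_{\varepsilon,\sigma,h}}\le\frac1\beta\|f\|_{\mathcal V'}.$$ 2. For all $\varepsilon\ge0$ and $\sigma=0$ the problem $(S_{A_h})$ has a unique solution $(u_h^{\varepsilon,0},\xi_h^{\varepsilon,0})\in V_h\times A_h$, and for every fixed $\varepsilon\ge0$, $u_h^{\varepsilon,\sigma}\to u_h^{\varepsilon,0}$ and $\xi_h^{\varepsilon,\sigma}\to\xi_h^{\varepsilon,0}$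 as $\sigma\to0^+$ (in the $H^1$ norm, equivalently in any norm of the finite-dimensional space $V_h$). 3. $u_h^{\varepsilon,0}\to u_h^{0,0}$ and $\xi_h^{\varepsilon,0}\to\xi_h^{0,0}$ as $\varepsilon\to0^+$, in the same sense. 4. Fix bases $(\varphi_i)$ and $(\psi_i)$ of $V_h$ and $\sigma>0$, and let $\mathbb A^{\varepsilon,\sigma}$ be the matrix of $(S_{V_h})$ with $u$ and $v$ expanded in $(\varphi_i)$ and $\xi$ and $w$ in $(\psi_i)$. There is a constant $C$, which may depend on $\sigma$ but not on $\varepsilon$, such that for all $\varepsilon\in[0,1]$ the matrix $\mathbb A^{\varepsilon,\sigma}$ is invertible and $\mathrm{cond}_2(\mathbb A^{\varepsilon,\sigma})=\|\mathbb A^{\varepsilon,\sigma}\|_2\,\|(\mathbb A^{\varepsilon,\sigma})^{-1}\|_2\le C$. -/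

import Mathlib

open MeasureTheory Set Filter Topology
open scoped ENNReal RealInnerProductSpace ContDiff Matrix

noncomputable section

namespace AnisoAP

/-- The Euclidean space `ℝᵈ`. -/
abbrev E (d : ℕ) := EuclideanSpace ℝ (Fin d)

/-! ### Domains, normals, Sobolev space, traces -/

/-- Lipschitz boundary: near each boundary point, `Ω` is, in suitable orthonormal coordinates
with last axis `e`, the set lying strictly above the graph of a Lipschitz function of the other
coordinates (`γ` does not depend on the coordinate along `e`). -/
def HasLipschitzBoundary {d : ℕ} (Ω : Set (E d)) : Prop :=
  ∀ x ∈ frontier Ω, ∃ (e : E d) (γ : E d → ℝ) (K : NNReal) (r : ℝ),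
    ‖e‖ = 1 ∧ LipschitzWith K γ ∧ (∀ (y : E d) (t : ℝ), γ (y + t • e) = γ y) ∧ 0 < r ∧
      ∀ y ∈ Metric.ball x r, y ∈ Ω ↔ γ y < ⟪e, y⟫

/-- `n` is the unit outward normal to `Ω` at the boundary point `x`: the half space
`{y | ⟪y - x, n⟫ < 0}` is tangent to `Ω` at `x`. -/
def IsOutwardNormal {d : ℕ} (Ω : Set (E d)) (x n : E d) : Prop :=
  x ∈ frontier Ω ∧ ‖n‖ = 1 ∧ ∀ η : ℝ, 0 < η → ∀ᶠ y in 𝓝 x,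
    (⟪y - x, n⟫ < -(η * ‖y - x‖) → y ∈ Ω) ∧ (η * ‖y - x‖ < ⟪y - x, n⟫ → y ∉ Ω)

/-- The surface measure on the boundary of `Ω` (Hausdorff measure of dimension `d - 1`). -/
def surfaceMeasure {d : ℕ} (Ω : Set (E d)) : Measure (E d) :=
  (Measure.hausdorffMeasure ((d : ℝ) - 1)).restrict (frontier Ω)

/-- Pairs (function, vector field) in `L²(Ω) × L²(Ω)ᵈ`, with the product topology. -/
abbrev L2Pair {d : ℕ} (Ω : Set (E d)) :=
  Lp ℝ 2 (volume.restrict Ω) × Lp (E d) 2 (volume.restrict Ω)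

lemma integrable_smul_gradient {d : ℕ} {Ω : Set (E d)} (u : Lp ℝ 2 (volume.restrict Ω))
    {φ : E d → ℝ} (h : ContDiff ℝ ∞ φ) (hc : HasCompactSupport φ) :
    Integrable (fun x => u x • gradient φ x) (volume.restrict Ω) := by
  have hg : Continuous (gradient φ) := by
    unfold gradient
    exact (LinearIsometryEquiv.continuous _).comp (h.continuous_fderiv (by simp))
  have hgc : HasCompactSupport (gradient φ) := by
    unfold gradient
    exact (hc.fderiv ℝ).comp_left (by simp)
  exact memLp_one_iff_integrable.1 (MemLp.smul (p := 2) (q := 2) (r := 1)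
    (hg.memLp_of_hasCompactSupport hgc) (Lp.memLp u))

lemma integrable_test_smul {d : ℕ} {Ω : Set (E d)} (g : Lp (E d) 2 (volume.restrict Ω))
    {φ : E d → ℝ} (h : ContDiff ℝ ∞ φ) (hc : HasCompactSupport φ) :
    Integrable (fun x => φ x • g x) (volume.restrict Ω) :=
  memLp_one_iff_integrable.1 (MemLp.smul (p := 2) (q := 2) (r := 1)
    (Lp.memLp g) (h.continuous.memLp_of_hasCompactSupport hc))

/-- `H¹(Ω)`, an element being recorded as the pair `(u, ∇u)` of the function and of its
(unique) weak gradient. -/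
def H1 {d : ℕ} (Ω : Set (E d)) : Submodule ℝ (L2Pair Ω) where
  carrier := {p | ∀ φ : E d → ℝ, ContDiff ℝ ∞ φ → HasCompactSupport φ → tsupport φ ⊆ Ω →
    ∫ x in Ω, p.1 x • gradient φ x = -∫ x in Ω, φ x • p.2 x}
  zero_mem' := by
    intro φ _ _ _
    have h1 : ∫ x in Ω, (0 : Lp ℝ 2 (volume.restrict Ω)) x • gradient φ x = 0 := by
      apply integral_eq_zero_of_ae
      filter_upwards [Lp.coeFn_zero ℝ 2 (volume.restrict Ω)] with x hx
      rw [hx]; simp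
    have h2 : ∫ x in Ω, φ x • (0 : Lp (E d) 2 (volume.restrict Ω)) x = 0 := by
      apply integral_eq_zero_of_ae
      filter_upwards [Lp.coeFn_zero (E d) 2 (volume.restrict Ω)] with x hx
      rw [hx]; simp
    exact h1.trans (by rw [← neg_zero, neg_inj]; exact h2.symm)
  add_mem' := by
    intro p q hp hq φ h hc hs
    have h1 : ∫ x in Ω, (p.1 + q.1) x • gradient φ x =
        ∫ x in Ω, (p.1 x • gradient φ x + q.1 x • gradient φ x) := by
      apply integral_congr_ae
      filter_upwards [Lp.coeFn_add p.1 q.1] with x hx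
      rw [hx, Pi.add_apply, add_smul]
    have h2 : ∫ x in Ω, φ x • (p.2 + q.2) x = ∫ x in Ω, (φ x • p.2 x + φ x • q.2 x) := by
      apply integral_congr_ae
      filter_upwards [Lp.coeFn_add p.2 q.2] with x hx
      rw [hx, Pi.add_apply, smul_add]
    change ∫ x in Ω, (p.1 + q.1) x • gradient φ x = -∫ x in Ω, φ x • (p.2 + q.2) x
    rw [h1, h2, integral_add (integrable_smul_gradient _ h hc) (integrable_smul_gradient _ h hc),
      integral_add (integrable_test_smul _ h hc) (integrable_test_smul _ h hc),
      hp φ h hc hs, hq φ h hc hs, neg_add]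
  smul_mem' := by
    intro c p hp φ h hc hs
    have h1 : ∫ x in Ω, (c • p.1) x • gradient φ x = ∫ x in Ω, c • (p.1 x • gradient φ x) := by
      apply integral_congr_ae
      filter_upwards [Lp.coeFn_smul c p.1] with x hx
      simp [hx, mul_smul]
    have h2 : ∫ x in Ω, φ x • (c • p.2) x = ∫ x in Ω, c • (φ x • p.2 x) := by
      apply integral_congr_ae
      filter_upwards [Lp.coeFn_smul c p.2] with x hx
      simp [hx, smul_comm c (φ x)]
    change ∫ x in Ω, (c • p.1) x • gradient φ x = -∫ x in Ω, φ x • (c • p.2) x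
    rw [h1, h2, integral_smul, integral_smul, hp φ h hc hs, smul_neg]

/-- `g ∈ L²(Γ)` is the boundary trace of `p = (u, ∇u)`: there are smooth functions `φₙ` with
`φₙ → u` in `H¹(Ω)` and `φₙ → g` in `L²(Γ)`. -/
def HasTrace {d : ℕ} {Ω : Set (E d)} (p : L2Pair Ω) (g : E d → ℝ) : Prop :=
  MemLp g 2 (surfaceMeasure Ω) ∧ ∃ φ : ℕ → E d → ℝ, (∀ n, ContDiff ℝ ∞ (φ n)) ∧
    Tendsto (fun n => eLpNorm (fun x => φ n x - p.1 x) 2 (volume.restrict Ω)) atTop (𝓝 0) ∧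
    Tendsto (fun n => eLpNorm (fun x => gradient (φ n) x - p.2 x) 2 (volume.restrict Ω))
      atTop (𝓝 0) ∧
    Tendsto (fun n => eLpNorm (fun x => φ n x - g x) 2 (surfaceMeasure Ω)) atTop (𝓝 0)

lemma continuous_gradient {d : ℕ} {φ : E d → ℝ} (h : ContDiff ℝ ∞ φ) :
    Continuous (gradient φ) := by
  unfold gradient
  exact (LinearIsometryEquiv.continuous _).comp (h.continuous_fderiv (by simp))

lemma tendsto_eLpNorm_add {α F : Type*} [MeasurableSpace α] [NormedAddCommGroup F]
    {μ : Measure α} {f g h : ℕ → α → F}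
    (hf : ∀ n, AEStronglyMeasurable (f n) μ) (hg : ∀ n, AEStronglyMeasurable (g n) μ)
    (hh : ∀ n, h n =ᵐ[μ] f n + g n)
    (h1 : Tendsto (fun n => eLpNorm (f n) 2 μ) atTop (𝓝 0))
    (h2 : Tendsto (fun n => eLpNorm (g n) 2 μ) atTop (𝓝 0)) :
    Tendsto (fun n => eLpNorm (h n) 2 μ) atTop (𝓝 0) := by
  refine tendsto_of_tendsto_of_tendsto_of_le_of_le tendsto_const_nhds
    (by simpa using h1.add h2) (fun _ => zero_le) (fun n => ?_)
  change eLpNorm (h n) 2 μ ≤ _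
  rw [eLpNorm_congr_ae (hh n)]
  exact eLpNorm_add_le (hf n) (hg n) (by norm_num)

lemma tendsto_eLpNorm_smul {α F : Type*} [MeasurableSpace α] [NormedAddCommGroup F]
    [NormedSpace ℝ F] {μ : Measure α} {f h : ℕ → α → F} (c : ℝ)
    (hh : ∀ n, h n =ᵐ[μ] c • f n)
    (h1 : Tendsto (fun n => eLpNorm (f n) 2 μ) atTop (𝓝 0)) :
    Tendsto (fun n => eLpNorm (h n) 2 μ) atTop (𝓝 0) := by
  have : Tendsto (fun n => ‖c‖ₑ * eLpNorm (f n) 2 μ) atTop (𝓝 0) := by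
    simpa using ENNReal.Tendsto.const_mul h1 (Or.inr enorm_ne_top)
  refine this.congr (fun n => ?_)
  rw [eLpNorm_congr_ae (hh n), eLpNorm_const_smul]

lemma gradient_add_smooth {d : ℕ} {φ ψ : E d → ℝ} (h : ContDiff ℝ ∞ φ) (k : ContDiff ℝ ∞ ψ)
    (x : E d) : gradient (fun y => φ y + ψ y) x = gradient φ x + gradient ψ x := by
  unfold gradient
  rw [show (fun y => φ y + ψ y) = φ + ψ from rfl,
    fderiv_add (h.differentiable (by simp) x) (k.differentiable (by simp) x), map_add]

lemma gradient_const_mul_smooth {d : ℕ} {φ : E d → ℝ} (c : ℝ) (h : ContDiff ℝ ∞ φ)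
    (x : E d) : gradient (fun y => c * φ y) x = c • gradient φ x := by
  unfold gradient
  rw [fderiv_const_mul (h.differentiable (by simp) x)]
  simp

lemma HasTrace.zero {d : ℕ} {Ω : Set (E d)} : HasTrace (0 : L2Pair Ω) 0 := by
  refine ⟨MemLp.zero, fun _ _ => 0, fun _ => contDiff_const, ?_, ?_, ?_⟩
  · refine tendsto_const_nhds.congr (fun n => ?_)
    symm
    rw [eLpNorm_congr_ae (g := 0), eLpNorm_zero]
    filter_upwards [Lp.coeFn_zero ℝ 2 (volume.restrict Ω)] with x hx
    rw [Prod.fst_zero, hx]; simp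
  · refine tendsto_const_nhds.congr (fun n => ?_)
    symm
    rw [eLpNorm_congr_ae (g := 0), eLpNorm_zero]
    filter_upwards [Lp.coeFn_zero (E d) 2 (volume.restrict Ω)] with x hx
    rw [Prod.snd_zero, hx]; simp [gradient]
  · simp

lemma HasTrace.add {d : ℕ} {Ω : Set (E d)} {p q : L2Pair Ω} {g k : E d → ℝ}
    (hp : HasTrace p g) (hq : HasTrace q k) : HasTrace (p + q) (g + k) := by
  obtain ⟨hg, φ, hφ, a1, a2, a3⟩ := hp
  obtain ⟨hk, ψ, hψ, b1, b2, b3⟩ := hq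
  refine ⟨hg.add hk, fun n x => φ n x + ψ n x, fun n => (hφ n).add (hψ n), ?_, ?_, ?_⟩
  · refine tendsto_eLpNorm_add (fun n => ?_) (fun n => ?_) (fun n => ?_) a1 b1
    · exact (hφ n).continuous.aestronglyMeasurable.sub (Lp.aestronglyMeasurable _)
    · exact (hψ n).continuous.aestronglyMeasurable.sub (Lp.aestronglyMeasurable _)
    · filter_upwards [Lp.coeFn_add p.1 q.1] with x hx
      simp only [Prod.fst_add, hx, Pi.add_apply]
      ring
  · refine tendsto_eLpNorm_add (fun n => ?_) (fun n => ?_) (fun n => ?_) a2 b2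
    · exact (continuous_gradient (hφ n)).aestronglyMeasurable.sub (Lp.aestronglyMeasurable _)
    · exact (continuous_gradient (hψ n)).aestronglyMeasurable.sub (Lp.aestronglyMeasurable _)
    · filter_upwards [Lp.coeFn_add p.2 q.2] with x hx
      simp only [Prod.snd_add, hx, Pi.add_apply, gradient_add_smooth (hφ n) (hψ n)]
      abel
  · refine tendsto_eLpNorm_add (fun n => ?_) (fun n => ?_) (fun n => ?_) a3 b3
    · exact (hφ n).continuous.aestronglyMeasurable.sub hg.1
    · exact (hψ n).continuous.aestronglyMeasurable.sub hk.1
    · refine Eventually.of_forall (fun x => ?_)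
      simp only [Pi.add_apply]
      ring

lemma HasTrace.smul {d : ℕ} {Ω : Set (E d)} {p : L2Pair Ω} {g : E d → ℝ} (c : ℝ)
    (hp : HasTrace p g) : HasTrace (c • p) (c • g) := by
  obtain ⟨hg, φ, hφ, a1, a2, a3⟩ := hp
  refine ⟨hg.const_smul c, fun n x => c * φ n x, fun n => contDiff_const.mul (hφ n), ?_, ?_, ?_⟩
  · refine tendsto_eLpNorm_smul c (fun n => ?_) a1
    filter_upwards [Lp.coeFn_smul c p.1] with x hx
    simp only [Prod.smul_fst, hx, Pi.smul_apply, smul_eq_mul]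
    ring
  · refine tendsto_eLpNorm_smul c (fun n => ?_) a2
    filter_upwards [Lp.coeFn_smul c p.2] with x hx
    simp only [Prod.smul_snd, hx, Pi.smul_apply, gradient_const_mul_smooth c (hφ n), smul_sub]
  · refine tendsto_eLpNorm_smul c (fun n => ?_) a3
    refine Eventually.of_forall (fun x => ?_)
    simp only [Pi.smul_apply, smul_eq_mul]
    ring

/-! ### The anisotropic problem -/

/-- The data: domain `Ω`, direction field `b`, coefficients `A_∥` and `A_⊥`. -/
structure Problem (d : ℕ) where
  Ω : Set (E d)
  b : E d → E d
  Apar : E d → ℝ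
  Aperp : E d → Matrix (Fin d) (Fin d) ℝ

namespace Problem

variable {d : ℕ} (P : Problem d)

/-- The part `Γ_D` of the boundary on which `b · n = 0`. -/
def ΓD : Set (E d) := {x | ∃ n : E d, IsOutwardNormal P.Ω x n ∧ ⟪P.b x, n⟫ = 0}

/-- The matrix `b ⊗ b`. -/
def bb (x : E d) : Matrix (Fin d) (Fin d) ℝ := Matrix.vecMulVec (P.b x).ofLp (P.b x).ofLp

/-- The diffusion matrix `A = (b ⊗ b) A_∥ (b ⊗ b) + (Id - b ⊗ b) A_⊥ (Id - b ⊗ b)`. -/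
def A (x : E d) : Matrix (Fin d) (Fin d) ℝ :=
  P.bb x * (P.Apar x • (1 : Matrix (Fin d) (Fin d) ℝ)) * P.bb x +
    (1 - P.bb x) * P.Aperp x * (1 - P.bb x)

/-- Standing assumptions on the domain, the field and the coefficients. -/
structure HypothesisA : Prop where
  isOpen : IsOpen P.Ω
  isConnected : IsConnected P.Ω
  isBounded : Bornology.IsBounded P.Ω
  lipschitz : HasLipschitzBoundary P.Ω
  b_smooth : ContDiffOn ℝ ∞ P.b P.Ω
  b_continuous : ContinuousOn P.b (closure P.Ω)
  b_unit : ∀ x ∈ P.Ω, ‖P.b x‖ = 1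
  /-- `Γ_D` has nonempty interior, relative to the boundary. -/
  ΓD_interior : ∃ U : Set (E d), IsOpen U ∧ (U ∩ frontier P.Ω).Nonempty ∧
    U ∩ frontier P.Ω ⊆ P.ΓD
  Apar_measurable : AEMeasurable P.Apar (volume.restrict P.Ω)
  Aperp_measurable : ∀ i j, AEMeasurable (fun x => P.Aperp x i j) (volume.restrict P.Ω)
  A_symm : ∀ᵐ x ∂(volume.restrict P.Ω), (P.A x).IsSymm
  bounds : ∃ A₀ A₁ : ℝ, 0 < A₀ ∧ A₀ ≤ A₁ ∧
    (∀ᵐ x ∂(volume.restrict P.Ω), A₀ ≤ P.Apar x ∧ P.Apar x ≤ A₁) ∧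
    (∀ᵐ x ∂(volume.restrict P.Ω), ∀ v : E d, ⟪v, P.b x⟫ = 0 →
      A₀ * ‖v‖ ^ 2 ≤ v.ofLp ⬝ᵥ (P.Aperp x *ᵥ v.ofLp) ∧
      v.ofLp ⬝ᵥ (P.Aperp x *ᵥ v.ofLp) ≤ A₁ * ‖v‖ ^ 2)

/-- The space `𝒱` of all `v ∈ H¹(Ω)` with `v = 0` on `Γ_D` in the sense of traces. It carries
the topology of `H¹(Ω)`. -/
def V : Submodule ℝ (L2Pair P.Ω) where
  carrier := {p | p ∈ H1 P.Ω ∧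
    ∃ g : E d → ℝ, HasTrace p g ∧ ∀ᵐ x ∂(surfaceMeasure P.Ω), x ∈ P.ΓD → g x = 0}
  zero_mem' := ⟨zero_mem _, 0, HasTrace.zero, Eventually.of_forall fun _ _ => rfl⟩
  add_mem' := by
    rintro p q ⟨hp, g, hg, hg0⟩ ⟨hq, k, hk, hk0⟩
    refine ⟨add_mem hp hq, g + k, hg.add hk, ?_⟩
    filter_upwards [hg0, hk0] with x h1 h2 hx
    simp [h1 hx, h2 hx]
  smul_mem' := by
    rintro c p ⟨hp, g, hg, hg0⟩
    refine ⟨Submodule.smul_mem _ c hp, c • g, hg.smul c, ?_⟩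
    filter_upwards [hg0] with x h1 hx
    simp [h1 hx]

variable {P}

/-- The function underlying an element of `𝒱`. -/
def val (u : P.V) : E d → ℝ := fun x => u.1.1 x

/-- The weak gradient of an element of `𝒱`. -/
def grad (u : P.V) : E d → E d := fun x => u.1.2 x

/-- The parallel gradient `∇_∥ u = (b · ∇u) b`. -/
def gradPar (u : P.V) : E d → E d := fun x => ⟪P.b x, grad u x⟫ • P.b x

/-- `a(u, v) = ∫_Ω A ∇u · ∇v`. -/
def a (u v : P.V) : ℝ := ∫ x in P.Ω, (P.A x *ᵥ (grad u x).ofLp) ⬝ᵥ (grad v x).ofLp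

/-- `a_∥(u, v) = ∫_Ω A_∥ ∇_∥u · ∇_∥v`. -/
def aPar (u v : P.V) : ℝ := ∫ x in P.Ω, P.Apar x * ⟪gradPar u x, gradPar v x⟫

/-- The scalar product of `L²(Ω)`. -/
def l2 (u v : P.V) : ℝ := ∫ x in P.Ω, val u x * val v x

/-- `|u|_𝒱 = a(u, u)^{1/2}`. -/
def normV (u : P.V) : ℝ := √(a u u)

/-- `f` belongs to the dual `𝒱'` of `(𝒱, |·|_𝒱)`. -/
def InDual (f : P.V →ₗ[ℝ] ℝ) : Prop := ∃ C : ℝ, ∀ v : P.V, |f v| ≤ C * normV v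

/-- `‖f‖_{𝒱'}`, the supremum of `f(v) / |v|_𝒱` over `v ∈ 𝒱` (with the convention `0 / 0 = 0`). -/
def dualNorm (f : P.V →ₗ[ℝ] ℝ) : ℝ := ⨆ v : P.V, f v / normV v

/-! ### The discrete problems -/

/-- `G_h`: the elements of `V_h` with `∇_∥ v = 0`. -/
def Gh (Vh : Submodule ℝ P.V) : Set P.V :=
  {v | v ∈ Vh ∧ ∀ᵐ x ∂(volume.restrict P.Ω), gradPar v x = 0}

/-- `A_h`: the `L²`-orthogonal complement of `G_h` in `V_h`. -/
def Ah (Vh : Submodule ℝ P.V) : Set P.V := {ξ | ξ ∈ Vh ∧ ∀ w ∈ Gh Vh, l2 ξ w = 0}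

/-- The mesh-dependent `|ξ|_{*h}`, the supremum of `a_∥(ξ, v) / |v|_𝒱` over `v ∈ V_h`
(with the convention `0 / 0 = 0`). -/
def starNorm (Vh : Submodule ℝ P.V) (ξ : P.V) : ℝ := ⨆ v : Vh, aPar ξ v / normV (v : P.V)

/-- `‖u, ξ‖_{X_{ε,σ,h}} = (|u|_𝒱² + |ξ|_{*h}² + ε |ξ|_∥² + σ ‖ξ‖_{L²}²)^{1/2}`. -/
def normX (Vh : Submodule ℝ P.V) (ε σ : ℝ) (x : P.V × P.V) : ℝ :=
  √(normV x.1 ^ 2 + starNorm Vh x.2 ^ 2 + ε * aPar x.2 x.2 + σ * l2 x.2 x.2)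

/-- `x = (u, ξ)` belongs to `V_h × W_h` and satisfies
`a(u, v) + (1 - ε) a_∥(ξ, v) = f(v)` for all `v ∈ V_h`, and
`a_∥(u, w) - ε a_∥(ξ, w) - σ (ξ, w) = 0` for all `w ∈ W_h`. -/
def SolvesOn (f : P.V →ₗ[ℝ] ℝ) (Vh : Submodule ℝ P.V) (Wh : Set P.V) (ε σ : ℝ)
    (x : P.V × P.V) : Prop :=
  x.1 ∈ Vh ∧ x.2 ∈ Wh ∧
  (∀ v ∈ Vh, a x.1 v + (1 - ε) * aPar x.2 v = f v) ∧
  (∀ w ∈ Wh, aPar x.1 w - ε * aPar x.2 w - σ * l2 x.2 w = 0)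

/-- The stabilized discrete scheme, on `V_h × V_h`. -/
def SolvesScheme (f : P.V →ₗ[ℝ] ℝ) (Vh : Submodule ℝ P.V) (ε σ : ℝ) (x : P.V × P.V) : Prop :=
  SolvesOn f Vh (Vh : Set P.V) ε σ x

/-- The discrete problem on `V_h × A_h`. -/
def SolvesReduced (f : P.V →ₗ[ℝ] ℝ) (Vh : Submodule ℝ P.V) (ε σ : ℝ) (x : P.V × P.V) : Prop :=
  SolvesOn f Vh (Ah Vh) ε σ x

/-- The matrix of the scheme, for a basis `φ` of `V_h` used for the unknown `u` and the first
equation, and a basis `ψ` of `V_h` used for `ξ` and the second equation. Rows correspond to test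
functions, columns to unknowns. -/
def systemMatrix {Vh : Submodule ℝ P.V} {N : ℕ} (φ ψ : Module.Basis (Fin N) ℝ Vh) (ε σ : ℝ) :
    Matrix (Fin N ⊕ Fin N) (Fin N ⊕ Fin N) ℝ :=
  Matrix.fromBlocks
    (Matrix.of fun i j => a (φ j : P.V) (φ i))
    (Matrix.of fun i j => (1 - ε) * aPar (ψ j : P.V) (φ i))
    (Matrix.of fun i j => aPar (φ j : P.V) (ψ i))
    (Matrix.of fun i j => -(ε * aPar (ψ j : P.V) (ψ i)) - σ * l2 (ψ j : P.V) (ψ i))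

end Problem

/-- The spectral condition number `‖M‖₂ ‖M⁻¹‖₂` (meaningful for invertible `M`). -/
def cond2 {ι : Type*} [Fintype ι] [DecidableEq ι] (M : Matrix ι ι ℝ) : ℝ :=
  ‖Matrix.toEuclideanCLM (𝕜 := ℝ) M‖ * ‖Matrix.toEuclideanCLM (𝕜 := ℝ) M⁻¹‖

end AnisoAP

end

namespace AnisoAP

/-! ### Gradient control of translates in L¹ -/

variable {d : ℕ}

/-! In finite dimension, existence follows from uniqueness, and uniqueness is an energy argument.
Testing with `u` and `ξ` gives `a(u,u) + (1-ε) T = f(u)` with `T = a_∥(ξ,u) = ε a_∥(ξ,ξ) + σ (ξ,ξ) ≥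
0`. When `f = 0` this forces `u = 0` for `ε ≤ 1`; for `ε > 1` Cauchy-Schwarz and `a_∥ ≤ a` are
needed as well (`homogeneous_eq_zero`). Then `a_∥(ξ,ξ) = 0`, and either `σ > 0` or orthogonality to
the kernel of `a_∥` gives `ξ = 0`.

The same identities give the uniform bound (`normX_le`): for small `ε` the first equation controls
`ξ`, for `ε` near `1` the term `ε a_∥(ξ,ξ)` does.

A stabilized solution automatically lies in `A_h`, so it also solves the reduced problem. The latter
is uniquely solvable on the closed quadrant `ε, σ ≥ 0`, its operator is affine in `(ε, σ)`, and
inversion is continuous at units: both limits are instances of this continuity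
(`exists_continuous_solution`). The condition number is likewise continuous on the compact interval
`[0,1]`.

The analytic input is that `a` is definite on `𝒱` (`eq_zero_of_grad_ae_eq_zero`). This is proved by
hand from smooth approximations: the vanishing trace is carried into `Ω` along the axis of a
Lipschitz chart, then spread by connectedness. -/

lemma enorm_sub_le_lintegral_segment {φ : E d → ℝ} (hφ : ContDiff ℝ ∞ φ) {S : Set (E d)}
    (y h : E d) {s δ : ℝ} (hs : 0 ≤ s) (hδ : s ≤ δ) (hS : ∀ τ ∈ Ioo 0 s, y + τ • h ∈ S) :
    ‖φ (y + s • h) - φ y‖ₑ ≤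
      ‖h‖ₑ * ∫⁻ τ in Ioo 0 δ, S.indicator (fun z => ‖gradient φ z‖ₑ) (y + τ • h) := by
  have hcont : Continuous fun τ : ℝ => ⟪gradient φ (y + τ • h), h⟫ :=
    ((continuous_gradient hφ).comp (by fun_prop)).inner continuous_const
  have hder : ∀ τ : ℝ, HasDerivAt (fun τ : ℝ => φ (y + τ • h)) ⟪gradient φ (y + τ • h), h⟫ τ := by
    intro τ
    have h1 : HasFDerivAt φ (fderiv ℝ φ (y + τ • h)) (y + τ • h) :=
      (hφ.differentiable (by simp) _).hasFDerivAt
    have h2 : HasDerivAt (fun τ : ℝ => y + τ • h) h τ := by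
      simpa using ((hasDerivAt_id τ).smul_const h).const_add y
    rw [inner_gradient_left]
    exact h1.comp_hasDerivAt τ h2
  have hftc := intervalIntegral.integral_eq_sub_of_hasDerivAt (a := 0) (b := s)
    (fun τ _ => hder τ) (hcont.intervalIntegrable _ _)
  have h0 : φ (y + s • h) - φ y = ∫ τ in Ioo 0 s, ⟪gradient φ (y + τ • h), h⟫ := by
    rw [intervalIntegral.integral_of_le hs, ← integral_Ioc_eq_integral_Ioo] at *
    simpa using hftc.symm
  rw [h0]
  calc ‖∫ τ in Ioo 0 s, ⟪gradient φ (y + τ • h), h⟫‖ₑ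
      ≤ ∫⁻ τ in Ioo 0 s, ‖⟪gradient φ (y + τ • h), h⟫‖ₑ := enorm_integral_le_lintegral_enorm _
    _ ≤ ∫⁻ τ in Ioo 0 s, ‖h‖ₑ * S.indicator (fun z => ‖gradient φ z‖ₑ) (y + τ • h) := by
        refine setLIntegral_mono' measurableSet_Ioo fun τ hτ => ?_
        rw [indicator_of_mem (hS τ hτ), ← ofReal_norm, ← ofReal_norm, ← ofReal_norm,
          ← ENNReal.ofReal_mul (norm_nonneg _)]
        exact ENNReal.ofReal_le_ofReal ((norm_inner_le_norm _ _).trans_eq (mul_comm _ _))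
    -- The indicator of `S` permits a fixed interval `(0, δ)` in place of `(0, s)`. When `s` depends
    -- on `y`, Tonelli and translation invariance then still apply.
    _ ≤ ∫⁻ τ in Ioo 0 δ, ‖h‖ₑ * S.indicator (fun z => ‖gradient φ z‖ₑ) (y + τ • h) :=
        lintegral_mono_set (Ioo_subset_Ioo_right hδ)
    _ = _ := lintegral_const_mul' _ _ enorm_ne_top

/-- The `L¹` distance between a smooth function and a translate of it along segments contained in
`S` is controlled by the `L¹(S)` norm of its gradient. -/
lemma lintegral_enorm_sub_le {φ : E d → ℝ} (hφ : ContDiff ℝ ∞ φ) {S T : Set (E d)}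
    (hS : MeasurableSet S) (hT : MeasurableSet T) (h : E d) (s : E d → ℝ) (δ : ℝ)
    (hs : ∀ y ∈ T, 0 ≤ s y ∧ s y ≤ δ ∧ ∀ τ ∈ Ioo 0 (s y), y + τ • h ∈ S) :
    ∫⁻ y in T, ‖φ (y + s y • h) - φ y‖ₑ ≤
      ‖h‖ₑ * (ENNReal.ofReal δ * ∫⁻ z in S, ‖gradient φ z‖ₑ) := by
  set G : E d → ℝ≥0∞ := S.indicator (fun z => ‖gradient φ z‖ₑ) with hG
  have hGm : Measurable G := (continuous_gradient hφ).measurable.enorm.indicator hS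
  calc ∫⁻ y in T, ‖φ (y + s y • h) - φ y‖ₑ
      ≤ ∫⁻ y in T, ‖h‖ₑ * ∫⁻ τ in Ioo 0 δ, G (y + τ • h) :=
        setLIntegral_mono' hT fun y hy =>
          enorm_sub_le_lintegral_segment hφ y h (hs y hy).1 (hs y hy).2.1 (hs y hy).2.2
    _ ≤ ∫⁻ y, ‖h‖ₑ * ∫⁻ τ in Ioo 0 δ, G (y + τ • h) := setLIntegral_le_lintegral _ _
    _ = ‖h‖ₑ * ∫⁻ y, ∫⁻ τ in Ioo 0 δ, G (y + τ • h) := lintegral_const_mul' _ _ enorm_ne_top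
    _ = ‖h‖ₑ * ∫⁻ τ in Ioo 0 δ, ∫⁻ y, G (y + τ • h) := by
        rw [lintegral_lintegral_swap]
        refine (hGm.comp ?_).aemeasurable
        fun_prop
    _ = ‖h‖ₑ * (ENNReal.ofReal δ * ∫⁻ z in S, ‖gradient φ z‖ₑ) := by
        simp_rw [lintegral_add_right_eq_self G]
        rw [lintegral_const, hG, lintegral_indicator hS]
        simp [mul_comm]

lemma tendsto_lintegral_enorm_of_eLpNorm {α F : Type*} [MeasurableSpace α] [NormedAddCommGroup F]
    {μ : Measure α} [IsFiniteMeasure μ] {f : ℕ → α → F} (hf : ∀ n, AEStronglyMeasurable (f n) μ)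
    (h : Tendsto (fun n => eLpNorm (f n) 2 μ) atTop (𝓝 0)) :
    Tendsto (fun n => ∫⁻ x, ‖f n x‖ₑ ∂μ) atTop (𝓝 0) := by
  set c : ℝ≥0∞ := μ univ ^ (1 / (1 : ℝ≥0∞).toReal - 1 / (2 : ℝ≥0∞).toReal) with hc
  have hc' : c ≠ ⊤ := ENNReal.rpow_ne_top_of_nonneg (by norm_num) (measure_ne_top _ _)
  have h' : Tendsto (fun n => eLpNorm (f n) 2 μ * c) atTop (𝓝 0) := by
    simpa using ENNReal.Tendsto.mul_const h (Or.inr hc')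
  refine tendsto_of_tendsto_of_tendsto_of_le_of_le tendsto_const_nhds h' (fun _ => zero_le)
    (fun n => ?_)
  change ∫⁻ x, ‖f n x‖ₑ ∂μ ≤ _
  rw [← eLpNorm_one_eq_lintegral_enorm]
  exact eLpNorm_le_eLpNorm_mul_rpow_measure_univ (by norm_num) (hf n)

/-- If `φₙ → u`, `ψₙ - φₙ → 0` and `ψₙ → 0` in `L¹`, then `u` vanishes. -/
lemma ae_eq_zero_of_tendsto_lintegral {α : Type*} [MeasurableSpace α] {μ : Measure α}
    {u : α → ℝ} (hu : AEStronglyMeasurable u μ) {φ ψ : ℕ → α → ℝ}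
    (hφ : ∀ n, AEStronglyMeasurable (φ n) μ) (hψ : ∀ n, AEStronglyMeasurable (ψ n) μ)
    (h1 : Tendsto (fun n => ∫⁻ x, ‖φ n x - u x‖ₑ ∂μ) atTop (𝓝 0))
    (h2 : Tendsto (fun n => ∫⁻ x, ‖ψ n x - φ n x‖ₑ ∂μ) atTop (𝓝 0))
    (h3 : Tendsto (fun n => ∫⁻ x, ‖ψ n x‖ₑ ∂μ) atTop (𝓝 0)) : u =ᵐ[μ] 0 := by
  have key : ∀ n, ∫⁻ x, ‖u x‖ₑ ∂μ ≤ ∫⁻ x, ‖φ n x - u x‖ₑ ∂μ + ∫⁻ x, ‖ψ n x - φ n x‖ₑ ∂μ +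
      ∫⁻ x, ‖ψ n x‖ₑ ∂μ := by
    intro n
    have m1 : AEMeasurable (fun x => ‖φ n x - u x‖ₑ) μ := ((hφ n).sub hu).enorm
    rw [← lintegral_add_left' m1, ← lintegral_add_right' _ (hψ n).enorm]
    refine lintegral_mono fun x => ?_
    have : u x = ψ n x - (ψ n x - φ n x) - (φ n x - u x) := by ring
    calc ‖u x‖ₑ = ‖ψ n x - (ψ n x - φ n x) - (φ n x - u x)‖ₑ := by rw [← this]
      _ ≤ ‖ψ n x - (ψ n x - φ n x)‖ₑ + ‖φ n x - u x‖ₑ := enorm_sub_le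
      _ ≤ ‖ψ n x‖ₑ + ‖ψ n x - φ n x‖ₑ + ‖φ n x - u x‖ₑ := by gcongr; exact enorm_sub_le
      _ = _ := by ring
  have hle : ∫⁻ x, ‖u x‖ₑ ∂μ ≤ 0 :=
    ge_of_tendsto' (by simpa using (h1.add h2).add h3) key
  have := (lintegral_eq_zero_iff' hu.enorm).1 (le_antisymm hle zero_le)
  filter_upwards [this] with x hx
  simpa using hx

/-! ### From a vanishing trace to vanishing on a ball -/

/-- The volume of a bounded piece of the cylinder over `T` with axis `e` is controlled by the
`(d - 1)`-dimensional Hausdorff measure of `T`. -/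
lemma volume_cylinder_le {n : ℕ} {e : E (n + 1)} (he : ‖e‖ = 1) (R : ℝ) :
    ∃ C : ℝ≥0∞, C ≠ ⊤ ∧ ∀ T : Set (E (n + 1)),
      volume {y : E (n + 1) | ‖y‖ ≤ R ∧ ∃ z ∈ T, ∃ t : ℝ, y = z + t • e} ≤
        C * Measure.hausdorffMeasure (n : ℝ) T := by
  obtain ⟨B, hB⟩ : ∃ B : OrthonormalBasis (Fin (n + 1)) ℝ (E (n + 1)), B 0 = e := by
    obtain ⟨B, hB⟩ := Orthonormal.exists_orthonormalBasis_extension_of_card_eq (𝕜 := ℝ)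
      (E := E (n + 1)) (ι := Fin (n + 1)) (by simp) (v := fun _ => e) (s := {0}) (by
        rw [orthonormal_iff_ite]
        rintro ⟨i, rfl⟩ ⟨j, rfl⟩
        simp [Set.domRestrict, he])
    exact ⟨B, hB 0 rfl⟩
  set F : E (n + 1) → ℝ × (Fin n → ℝ) := fun y =>
    MeasurableEquiv.piFinSuccAbove (fun _ => ℝ) 0 (B.repr y).ofLp with hF
  have hFmp : MeasurePreserving F volume volume :=
    ((volume_preserving_piFinSuccAbove (fun _ => ℝ) 0).comp (PiLp.volume_preserving_ofLp _)).comp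
      B.measurePreserving_repr
  set π : E (n + 1) → (Fin n → ℝ) := fun y => (F y).2 with hπ
  have hπi : ∀ y i, π y i = ⟪B i.succ, y⟫ := fun y i => by
    simp [hπ, hF, MeasurableEquiv.piFinSuccAbove, Fin.tail, OrthonormalBasis.repr_apply_apply]
  -- Forgetting the `e`-coordinate is 1-Lipschitz into `ℝⁿ` with the sup norm, where `n`-dimensional
  -- Hausdorff measure is Lebesgue measure. Hence the base of the cylinder has volume at most the
  -- Hausdorff measure of `T`.
  have hπL : LipschitzWith 1 π := by
    refine LipschitzWith.of_dist_le_mul fun y z => ?_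
    rw [NNReal.coe_one, one_mul, dist_pi_le_iff dist_nonneg]
    intro i
    rw [hπi, hπi, Real.dist_eq, ← inner_sub_right, dist_eq_norm]
    refine (abs_real_inner_le_norm _ _).trans ?_
    simp [B.orthonormal.1]
  refine ⟨ENNReal.ofReal (R - -R), ENNReal.ofReal_ne_top, fun T => ?_⟩
  calc volume {y : E (n + 1) | ‖y‖ ≤ R ∧ ∃ z ∈ T, ∃ t : ℝ, y = z + t • e}
      ≤ volume (F ⁻¹' (Icc (-R) R ×ˢ (π '' T))) := by
        refine measure_mono ?_
        rintro y ⟨hy, z, hz, t, rfl⟩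
        refine ⟨?_, z, hz, ?_⟩
        · have : (F (z + t • e)).1 = ⟪B 0, z + t • e⟫ := by
            simp [hF, MeasurableEquiv.piFinSuccAbove, OrthonormalBasis.repr_apply_apply]
          rw [this, mem_Icc, ← abs_le]
          refine (abs_real_inner_le_norm _ _).trans ?_
          simpa [B.orthonormal.1] using hy
        · funext i
          change π z i = π (z + t • e) i
          rw [hπi, hπi, inner_add_right, inner_smul_right, ← hB,
            B.inner_eq_zero (Fin.succ_ne_zero i)]
          simp
    -- `π '' T` need not be measurable, so it is replaced by a measurable hull of equal volume.
    _ ≤ volume (F ⁻¹' (Icc (-R) R ×ˢ toMeasurable volume (π '' T))) :=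
        measure_mono (preimage_mono (prod_mono_right (subset_toMeasurable _ _)))
    _ = volume (Icc (-R) R) * volume (π '' T) := by
        rw [hFmp.measure_preimage
          (measurableSet_Icc.prod (measurableSet_toMeasurable _ _)).nullMeasurableSet,
          Measure.volume_eq_prod, Measure.prod_prod, measure_toMeasurable]
    _ ≤ _ := by
        rw [Real.volume_Icc]
        gcongr
        rw [← hausdorffMeasure_pi_real, Fintype.card_fin]
        simpa using hπL.hausdorffMeasure_image_le (d := (n : ℝ)) (by positivity) T

/-- A function that is approximated by smooth functions whose gradients tend to zero, and whose
traces tend to zero on a relatively open piece of the boundary, vanishes near that piece. -/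
lemma exists_ball_ae_eq_zero {n : ℕ} {Ω U : Set (E (n + 1))} (hΩ : IsOpen Ω)
    (hL : HasLipschitzBoundary Ω) (hU : IsOpen U) (hne : (U ∩ frontier Ω).Nonempty)
    {u g : E (n + 1) → ℝ} (hu : AEStronglyMeasurable u (volume.restrict Ω))
    (hg0 : ∀ᵐ x ∂(surfaceMeasure Ω), x ∈ U → g x = 0)
    {φ : ℕ → E (n + 1) → ℝ} (hφ : ∀ k, ContDiff ℝ ∞ (φ k))
    (h1 : Tendsto (fun k => ∫⁻ x in Ω, ‖φ k x - u x‖ₑ) atTop (𝓝 0))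
    (h2 : Tendsto (fun k => ∫⁻ x in Ω, ‖gradient (φ k) x‖ₑ) atTop (𝓝 0))
    (h3 : Tendsto (fun k => eLpNorm (fun x => φ k x - g x) 2 (surfaceMeasure Ω)) atTop (𝓝 0)) :
    ∃ y ∈ Ω, ∃ r > 0, Metric.ball y r ⊆ Ω ∧ ∀ᵐ x ∂(volume.restrict (Metric.ball y r)), u x = 0 := by
  obtain ⟨x₀, hx₀U, hx₀⟩ := hne
  obtain ⟨e, γ, K, r, he, hγ, hinv, hr, hloc⟩ := hL x₀ hx₀
  have hγc : Continuous γ := hγ.continuous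
  have hee : ⟪e, e⟫ = 1 := by rw [real_inner_self_eq_norm_sq, he, one_pow]
  -- `s` is the height above the graph and `ρ` the projection onto the graph along `e`.
  set s : E (n + 1) → ℝ := fun y => ⟪e, y⟫ - γ y with hs
  set ρ : E (n + 1) → E (n + 1) := fun y => y + s y • (-e) with hρ
  have hsc : Continuous s := by fun_prop
  have hρc : Continuous ρ := by fun_prop
  have hγe : ∀ y (t : ℝ), γ (y + t • (-e)) = γ y := fun y t => by
    rw [smul_neg, ← neg_smul]; exact hinv y _
  have hie : ∀ y (t : ℝ), ⟪e, y + t • (-e)⟫ = ⟪e, y⟫ - t := fun y t => by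
    rw [inner_add_right, inner_smul_right, inner_neg_right, hee]; ring
  have hx₀Ω : x₀ ∉ Ω := by
    have := hx₀.2
    rwa [hΩ.interior_eq] at this
  -- A positive height would put `x₀` in the open set `Ω`; a negative one would give `x₀` a
  -- neighbourhood disjoint from `Ω`.
  have hsx₀ : s x₀ = 0 := by
    have h1 : ¬ γ x₀ < ⟪e, x₀⟫ := fun h => hx₀Ω ((hloc x₀ (Metric.mem_ball_self hr)).2 h)
    refine le_antisymm (by simp only [hs]; linarith) ?_
    by_contra hneg
    rw [not_le] at hneg
    obtain ⟨y, ⟨hy1, hy2⟩, hyΩ⟩ := mem_closure_iff.1 hx₀.1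
      ({y | s y < 0} ∩ Metric.ball x₀ r)
      ((isOpen_lt hsc continuous_const).inter Metric.isOpen_ball)
      ⟨hneg, Metric.mem_ball_self hr⟩
    have := (hloc y hy2).1 hyΩ
    simp only [hs, mem_ofPred_eq] at hy1
    linarith
  obtain ⟨η, hη, hηsub⟩ : ∃ η > 0,
      Metric.ball x₀ η ⊆ Metric.ball x₀ r ∩ ρ ⁻¹' (U ∩ Metric.ball x₀ r) := by
    refine Metric.isOpen_iff.1 (Metric.isOpen_ball.inter
      ((hU.inter Metric.isOpen_ball).preimage hρc)) x₀ ⟨Metric.mem_ball_self hr, ?_⟩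
    have : ρ x₀ = x₀ := by simp [hρ, hsx₀]
    rw [mem_preimage, this]
    exact ⟨hx₀U, Metric.mem_ball_self hr⟩
  set Q := Metric.ball x₀ η with hQ
  have hρΓ : ∀ y ∈ Q, ρ y ∈ frontier Ω := by
    intro y hy
    have hyr : ρ y ∈ Metric.ball x₀ r := (hηsub hy).2.2
    refine ⟨?_, fun hmem => ?_⟩
    · have ht : Tendsto (fun t : ℝ => ρ y + t • e) (𝓝[>] 0) (𝓝 (ρ y)) := by
        have : Continuous fun t : ℝ => ρ y + t • e := by fun_prop
        simpa using (this.tendsto 0).mono_left nhdsWithin_le_nhds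
      refine mem_closure_of_tendsto ht ?_
      filter_upwards [ht (Metric.isOpen_ball.mem_nhds hyr), self_mem_nhdsWithin] with t ht1 ht2
      refine (hloc _ ht1).2 ?_
      rw [hinv, hγe, inner_add_right, hie, inner_smul_right, hee]
      have : (0 : ℝ) < t := ht2
      simp only [hs]
      linarith
    · have := (hloc _ hyr).1 (interior_subset hmem)
      rw [hγe, hie] at this
      simp only [hs] at this
      linarith
  obtain ⟨C, hC, hCyl⟩ := volume_cylinder_le he (‖x₀‖ + η)
  set ν : Measure (E (n + 1)) := (volume.restrict Q).map ρ with hν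
  have : IsFiniteMeasure (volume.restrict Q) :=
    ⟨by simpa using (measure_ball_lt_top (μ := volume) (x := x₀) (r := η))⟩
  -- The part of `Q` projecting into `T` lies in a bounded cylinder over `T ∩ frontier Ω`. This
  -- domination turns convergence of traces in `L²(Γ)` into convergence of `φ k ∘ ρ` on `Q`.
  have hνle : ν ≤ C • surfaceMeasure Ω := by
    refine Measure.le_iff.2 fun T hT => ?_
    rw [hν, Measure.map_apply hρc.measurable hT, Measure.restrict_apply (hρc.measurable hT),
      Measure.smul_apply, surfaceMeasure, Measure.restrict_apply hT, smul_eq_mul]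
    have hd : (((n + 1 : ℕ) : ℝ) - 1) = n := by push_cast; ring
    rw [hd]
    refine (measure_mono ?_).trans (hCyl _)
    rintro y ⟨hyT, hyQ⟩
    refine ⟨?_, ρ y, ⟨hyT, hρΓ y hyQ⟩, s y, by simp [hρ]⟩
    have h1 : ‖y - x₀‖ < η := by simpa [hQ, dist_eq_norm] using hyQ
    have h2 := norm_add_le x₀ (y - x₀)
    rw [add_sub_cancel] at h2
    linarith
  have hac : ν ≪ surfaceMeasure Ω :=
    (Measure.absolutelyContinuous_of_le hνle).trans Measure.smul_absolutelyContinuous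
  have hg0ν : ∀ᵐ x ∂ν, g x = 0 := by
    have hUν : ∀ᵐ x ∂ν, x ∈ U := by
      refine (ae_map_iff (p := fun x => x ∈ U) hρc.aemeasurable hU.measurableSet).2 ?_
      filter_upwards [ae_restrict_mem Metric.isOpen_ball.measurableSet] with y hy
      exact (hηsub hy).2.1
    filter_upwards [hUν, hac.ae_le hg0] with x hx hx'
    exact hx' hx
  have hν2 : Tendsto (fun k => eLpNorm (φ k) 2 ν) atTop (𝓝 0) := by
    have hlim : Tendsto (fun k => C ^ (1 / (2 : ℝ≥0∞)).toReal •
        eLpNorm (fun x => φ k x - g x) 2 (surfaceMeasure Ω)) atTop (𝓝 0) := by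
      simpa using ENNReal.Tendsto.const_mul h3 (Or.inr
        (ENNReal.rpow_ne_top_of_nonneg (by positivity) hC))
    refine tendsto_of_tendsto_of_tendsto_of_le_of_le tendsto_const_nhds hlim (fun _ => zero_le)
      (fun k => ?_)
    change eLpNorm (φ k) 2 ν ≤ _
    rw [← eLpNorm_smul_measure_of_ne_top (by norm_num)]
    refine (eLpNorm_congr_ae ?_).trans_le (eLpNorm_mono_measure _ hνle)
    filter_upwards [hg0ν] with x hx
    simp [hx]
  have hν1 := tendsto_lintegral_enorm_of_eLpNorm
    (fun k => (hφ k).continuous.aestronglyMeasurable) hν2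
  have hQo : IsOpen (Q ∩ Ω) := Metric.isOpen_ball.inter hΩ
  -- Compare `φ k` with `φ k ∘ ρ`: the difference is bounded by the gradient along the segment from
  -- `y` to `ρ y`, and `φ k ∘ ρ` tends to zero by the trace condition.
  have hzero : u =ᵐ[volume.restrict (Q ∩ Ω)] 0 := by
    refine ae_eq_zero_of_tendsto_lintegral
      (hu.mono_measure (Measure.restrict_mono inter_subset_right le_rfl))
      (φ := φ) (ψ := fun k y => φ k (ρ y))
      (fun k => (hφ k).continuous.aestronglyMeasurable)
      (fun k => ((hφ k).continuous.comp hρc).aestronglyMeasurable) ?_ ?_ ?_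
    · exact tendsto_of_tendsto_of_tendsto_of_le_of_le tendsto_const_nhds h1 (fun _ => zero_le)
        (fun k => lintegral_mono_set inter_subset_right)
    · have hlim : Tendsto (fun k => ‖-e‖ₑ * (ENNReal.ofReal (2 * r) *
          ∫⁻ x in Ω, ‖gradient (φ k) x‖ₑ)) atTop (𝓝 0) := by
        have h4 : Tendsto (fun k => ENNReal.ofReal (2 * r) *
            ∫⁻ x in Ω, ‖gradient (φ k) x‖ₑ) atTop (𝓝 0) := by
          simpa only [mul_zero] using ENNReal.Tendsto.const_mul h2 (Or.inr ENNReal.ofReal_ne_top)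
        simpa only [mul_zero] using ENNReal.Tendsto.const_mul h4 (Or.inr (enorm_ne_top (x := -e)))
      refine tendsto_of_tendsto_of_tendsto_of_le_of_le tendsto_const_nhds hlim (fun _ => zero_le)
        (fun k => lintegral_enorm_sub_le (hφ k) hΩ.measurableSet hQo.measurableSet (-e) s (2 * r)
          ?_)
      rintro y ⟨hyQ, hyΩ⟩
      have hyr : y ∈ Metric.ball x₀ r := (hηsub hyQ).1
      have hρr : ρ y ∈ Metric.ball x₀ r := (hηsub hyQ).2.2
      have hpos : 0 < s y := sub_pos.2 ((hloc y hyr).1 hyΩ)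
      refine ⟨hpos.le, ?_, fun τ hτ => ?_⟩
      · have h1 : dist (ρ y) y = s y := by
          simp [hρ, norm_smul, he, abs_of_pos hpos]
        rw [← h1]
        have := dist_triangle_right (ρ y) y x₀
        rw [Metric.mem_ball] at hyr hρr
        linarith
      -- The open segment stays in the chart ball by convexity, and in `Ω` because `γ` is constant
      -- along `e` and the height `s y - τ` remains positive.
      · have hmem : y + τ • (-e) ∈ Metric.ball x₀ r := by
          have := (convex_ball x₀ r).add_smul_sub_mem hyr hρr (t := τ / s y)
            ⟨div_nonneg hτ.1.le hpos.le, (div_le_one hpos).2 hτ.2.le⟩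
          have e1 : ρ y - y = s y • (-e) := by simp [hρ]
          rwa [e1, smul_smul, div_mul_cancel₀ _ hpos.ne'] at this
        refine (hloc _ hmem).2 ?_
        rw [hγe, hie]
        have := hτ.2
        simp only [hs] at this
        linarith
    · refine tendsto_of_tendsto_of_tendsto_of_le_of_le tendsto_const_nhds hν1 (fun _ => zero_le)
        (fun k => ?_)
      change ∫⁻ y in Q ∩ Ω, ‖φ k (ρ y)‖ₑ ≤ ∫⁻ x, ‖φ k x‖ₑ ∂ν
      rw [hν, lintegral_map (hφ k).continuous.measurable.enorm hρc.measurable]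
      exact lintegral_mono_set inter_subset_left
  obtain ⟨y, hyQ, hyΩ⟩ := mem_closure_iff.1 hx₀.1 Q Metric.isOpen_ball (Metric.mem_ball_self hη)
  obtain ⟨t, ht, hsub⟩ := Metric.isOpen_iff.1 hQo y ⟨hyQ, hyΩ⟩
  exact ⟨y, hyΩ, t, ht, hsub.trans inter_subset_right,
    ae_restrict_of_ae_restrict_of_subset hsub hzero⟩

/-! ### Unique continuation by translation -/

/-- Almost everywhere vanishing propagates along translations inside `Ω`. -/
lemma ae_eq_zero_of_translate {Ω : Set (E d)} (hΩ : IsOpen Ω)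
    {u : E d → ℝ} (hu : AEStronglyMeasurable u (volume.restrict Ω))
    {φ : ℕ → E d → ℝ} (hφ : ∀ k, ContDiff ℝ ∞ (φ k))
    (h1 : Tendsto (fun k => ∫⁻ x in Ω, ‖φ k x - u x‖ₑ) atTop (𝓝 0))
    (h2 : Tendsto (fun k => ∫⁻ x in Ω, ‖gradient (φ k) x‖ₑ) atTop (𝓝 0))
    {T : Set (E d)} (hT : MeasurableSet T) (h : E d)
    (hTΩ : ∀ y ∈ T, ∀ τ ∈ Icc (0 : ℝ) 1, y + τ • h ∈ Ω)
    {T' : Set (E d)} (hT' : ∀ y, y + h ∈ T' ↔ y ∈ T) (hTm : MeasurableSet T') (hT'Ω : T' ⊆ Ω)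
    (h0 : ∀ᵐ x ∂(volume.restrict T'), u x = 0) :
    ∀ᵐ x ∂(volume.restrict T), u x = 0 := by
  have hsub : T ⊆ Ω := fun y hy => by simpa using hTΩ y hy 0 (by simp)
  have hc : Continuous fun y : E d => y + h := by fun_prop
  refine ae_eq_zero_of_tendsto_lintegral (hu.mono_measure (Measure.restrict_mono hsub le_rfl))
    (φ := φ) (ψ := fun k y => φ k (y + h))
    (fun k => (hφ k).continuous.aestronglyMeasurable)
    (fun k => ((hφ k).continuous.comp hc).aestronglyMeasurable) ?_ ?_ ?_
  · exact tendsto_of_tendsto_of_tendsto_of_le_of_le tendsto_const_nhds h1 (fun _ => zero_le)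
      (fun k => lintegral_mono_set hsub)
  · have hlim : Tendsto (fun k => ‖h‖ₑ * (ENNReal.ofReal 1 * ∫⁻ x in Ω, ‖gradient (φ k) x‖ₑ))
        atTop (𝓝 0) := by
      simpa using ENNReal.Tendsto.const_mul h2 (Or.inr enorm_ne_top)
    refine tendsto_of_tendsto_of_tendsto_of_le_of_le tendsto_const_nhds hlim (fun _ => zero_le)
      (fun k => ?_)
    have := lintegral_enorm_sub_le (hφ k) hΩ.measurableSet hT h (fun _ => 1) 1
      (fun y hy => ⟨zero_le_one, le_rfl, fun τ hτ => hTΩ y hy τ ⟨hτ.1.le, hτ.2.le⟩⟩)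
    simpa using this
  · refine tendsto_of_tendsto_of_tendsto_of_le_of_le tendsto_const_nhds h1 (fun _ => zero_le)
      (fun k => ?_)
    change ∫⁻ y in T, ‖φ k (y + h)‖ₑ ≤ ∫⁻ x in Ω, ‖φ k x - u x‖ₑ
    calc ∫⁻ y in T, ‖φ k (y + h)‖ₑ = ∫⁻ y, T'.indicator (fun z => ‖φ k z‖ₑ) (y + h) := by
          rw [← lintegral_indicator hT]
          refine lintegral_congr fun y => ?_
          by_cases hy : y ∈ T
          · rw [indicator_of_mem hy, indicator_of_mem ((hT' y).2 hy)]
          · rw [indicator_of_notMem hy, indicator_of_notMem (mt (hT' y).1 hy)]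
      _ = ∫⁻ z in T', ‖φ k z‖ₑ := by
          rw [lintegral_add_right_eq_self, lintegral_indicator hTm]
      _ = ∫⁻ z in T', ‖φ k z - u z‖ₑ := by
          refine lintegral_congr_ae ?_
          filter_upwards [h0] with z hz
          simp [hz]
      _ ≤ _ := lintegral_mono_set hT'Ω

/-- Unique continuation for functions with vanishing gradient on a connected open set. -/
lemma ae_eq_zero_of_isPreconnected {Ω : Set (E d)} (hΩ : IsOpen Ω) (hc : IsPreconnected Ω)
    {u : E d → ℝ} (hu : AEStronglyMeasurable u (volume.restrict Ω))
    {φ : ℕ → E d → ℝ} (hφ : ∀ k, ContDiff ℝ ∞ (φ k))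
    (h1 : Tendsto (fun k => ∫⁻ x in Ω, ‖φ k x - u x‖ₑ) atTop (𝓝 0))
    (h2 : Tendsto (fun k => ∫⁻ x in Ω, ‖gradient (φ k) x‖ₑ) atTop (𝓝 0))
    (h0 : ∃ y ∈ Ω, ∃ r > 0, Metric.ball y r ⊆ Ω ∧
      ∀ᵐ x ∂(volume.restrict (Metric.ball y r)), u x = 0) :
    ∀ᵐ x ∂(volume.restrict Ω), u x = 0 := by
  set S : Set (E d) := {y | ∃ r > 0, Metric.ball y r ⊆ Ω ∧
      ∀ᵐ x ∂(volume.restrict (Metric.ball y r)), u x = 0} with hS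
  have hSo : IsOpen S := by
    rw [Metric.isOpen_iff]
    rintro y ⟨r, hr, hrΩ, hr0⟩
    refine ⟨r, hr, fun z hz => ⟨r - dist z y, sub_pos.2 hz, ?_, ?_⟩⟩
    · exact (Metric.ball_subset_ball' (by simp)).trans hrΩ
    · exact ae_restrict_of_ae_restrict_of_subset (Metric.ball_subset_ball' (by simp)) hr0
  -- Connectedness: `S` is open, and relatively closed in `Ω` because a ball on which `u` vanishes
  -- can be slid to a nearby limit point `x`.
  have hΩS : Ω ⊆ S := by
    refine hc.subset_of_closure_inter_subset hSo ?_ ?_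
    · obtain ⟨y, hy, h⟩ := h0
      exact ⟨y, hy, h⟩
    · rintro x ⟨hxS, hxΩ⟩
      obtain ⟨R, hR, hRΩ⟩ := Metric.isOpen_iff.1 hΩ x hxΩ
      obtain ⟨y, ⟨r, hr, hrΩ, hr0⟩, hxy⟩ := Metric.mem_closure_iff.1 hxS R hR
      -- The bound `r` keeps the ball at `y` where `u` vanishes; the bound `R - dist x y` keeps the
      -- whole translation inside `ball x R`.
      have hρ : 0 < min r (R - dist x y) := lt_min hr (sub_pos.2 hxy)
      have hsub : Metric.ball y (min r (R - dist x y)) ⊆ Metric.ball y r :=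
        Metric.ball_subset_ball (min_le_left _ _)
      refine ⟨min r (R - dist x y), hρ, ?_, ?_⟩
      · exact (Metric.ball_subset_ball ((min_le_right _ _).trans (by simp))).trans hRΩ
      refine ae_eq_zero_of_translate hΩ hu hφ h1 h2 Metric.isOpen_ball.measurableSet (y - x) ?_
        (T' := Metric.ball y (min r (R - dist x y))) ?_ Metric.isOpen_ball.measurableSet
        (hsub.trans hrΩ) (ae_restrict_of_ae_restrict_of_subset hsub hr0)
      · intro z hz τ hτ
        apply hRΩ
        rw [Metric.mem_ball] at hz ⊢
        have hz' := hz.trans_le (min_le_right _ _)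
        rw [dist_eq_norm] at hz' ⊢
        rw [dist_comm x y, dist_eq_norm] at hz'
        have e : z + τ • (y - x) - x = (z - x) + τ • (y - x) := by abel
        rw [e]
        refine (norm_add_le _ _).trans_lt ?_
        rw [norm_smul, Real.norm_of_nonneg hτ.1]
        have := mul_le_mul_of_nonneg_right hτ.2 (norm_nonneg (y - x))
        linarith
      · intro z
        have e : z + (y - x) - y = z - x := by abel
        rw [Metric.mem_ball, Metric.mem_ball, dist_eq_norm (z + _), e, ← dist_eq_norm]
  rw [ae_restrict_iff'₀ hΩ.measurableSet.nullMeasurableSet, ae_iff]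
  refine measure_null_of_locally_null _ fun x hx => ?_
  have hxΩ : x ∈ Ω := by by_contra h; exact hx fun h' => absurd h' h
  obtain ⟨r, hr, hrΩ, hr0⟩ := hΩS hxΩ
  refine ⟨_, inter_mem_nhdsWithin _ (Metric.ball_mem_nhds x hr), ?_⟩
  rw [ae_restrict_iff' Metric.isOpen_ball.measurableSet, ae_iff] at hr0
  refine measure_mono_null ?_ hr0
  rintro z ⟨hz, hzb⟩ h
  exact hz fun _ => h hzb

/-! ### Definiteness on `𝒱` of the Dirichlet and `L²` forms -/

namespace Problem

variable {P : Problem d}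

lemma HypothesisA.isFiniteMeasure (hP : P.HypothesisA) :
    IsFiniteMeasure (volume.restrict P.Ω) :=
  ⟨by simpa using hP.isBounded.measure_lt_top⟩

/-- An element of `𝒱` whose gradient vanishes is zero: it is constant by connectedness, and its
trace vanishes on a set of positive surface measure. -/
lemma eq_zero_of_grad_ae_eq_zero (hd : d ≠ 0) (hP : P.HypothesisA) {u : P.V}
    (hu : ∀ᵐ x ∂(volume.restrict P.Ω), grad u x = 0) : u = 0 := by
  obtain ⟨n, rfl⟩ := Nat.exists_eq_succ_of_ne_zero hd
  have := hP.isFiniteMeasure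
  obtain ⟨⟨p, q⟩, hp, g, ⟨hg, φ, hφ, h1, h2, h3⟩, hg0⟩ := u
  change ∀ᵐ x ∂(volume.restrict P.Ω), q x = 0 at hu
  have hpm : AEStronglyMeasurable (p : E (n + 1) → ℝ) (volume.restrict P.Ω) :=
    Lp.aestronglyMeasurable p
  have h1' := tendsto_lintegral_enorm_of_eLpNorm
    (fun k => (hφ k).continuous.aestronglyMeasurable.sub hpm) h1
  have h2' : Tendsto (fun k => ∫⁻ x in P.Ω, ‖gradient (φ k) x‖ₑ) atTop (𝓝 0) := by
    refine (tendsto_lintegral_enorm_of_eLpNorm (fun k =>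
      (continuous_gradient (hφ k)).aestronglyMeasurable.sub (Lp.aestronglyMeasurable q)) h2).congr
      fun k => lintegral_congr_ae ?_
    filter_upwards [hu] with x hx
    simp [hx]
  obtain ⟨U, hU, hUne, hUsub⟩ := hP.ΓD_interior
  have hgU : ∀ᵐ x ∂(surfaceMeasure P.Ω), x ∈ U → g x = 0 := by
    have hΓ : ∀ᵐ x ∂(surfaceMeasure P.Ω), x ∈ frontier P.Ω :=
      ae_restrict_mem isClosed_frontier.measurableSet
    filter_upwards [hg0, hΓ] with x hx hxΓ hxU
    exact hx (hUsub ⟨hxU, hxΓ⟩)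
  have hp0 := ae_eq_zero_of_isPreconnected hP.isOpen hP.isConnected.isPreconnected hpm hφ h1' h2'
    (exists_ball_ae_eq_zero hP.isOpen hP.lipschitz hU hUne hpm hgU hφ h1' h2' h3)
  have hp0' : p = 0 := (Lp.eq_zero_iff_ae_eq_zero).2 hp0
  have hq0' : q = 0 := (Lp.eq_zero_iff_ae_eq_zero).2 hu
  exact Subtype.ext (Prod.ext hp0' hq0')

/-- The weak gradient of an element of `𝒱` is determined by the function. -/
lemma eq_zero_of_val_ae_eq_zero (hP : P.HypothesisA) {u : P.V}
    (hu : ∀ᵐ x ∂(volume.restrict P.Ω), val u x = 0) : u = 0 := by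
  obtain ⟨⟨p, q⟩, hp, hg⟩ := u
  change ∀ᵐ x ∂(volume.restrict P.Ω), p x = 0 at hu
  have := hP.isFiniteMeasure
  have hq : ∀ᵐ x ∂(volume.restrict P.Ω), x ∈ P.Ω → q x = 0 := by
    -- Fundamental lemma of the calculus of variations: the weak gradient of the zero function
    -- integrates to zero against every test function.
    refine hP.isOpen.ae_eq_zero_of_integral_contDiff_smul_eq_zero ?_ fun φ h1 h2 h3 => ?_
    · exact ((Lp.memLp q).integrable (by norm_num)).locallyIntegrable.locallyIntegrableOn _
    · have h := hp φ h1 h2 h3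
      have h0 : ∫ x in P.Ω, p x • gradient φ x = 0 := by
        refine integral_eq_zero_of_ae ?_
        filter_upwards [hu] with x hx
        simp [hx]
      change ∫ x in P.Ω, p x • gradient φ x = -∫ x in P.Ω, φ x • q x at h
      rw [h0] at h
      exact neg_eq_zero.1 h.symm
  have hq' : ∀ᵐ x ∂(volume.restrict P.Ω), q x = 0 := by
    filter_upwards [hq, ae_restrict_mem hP.isOpen.measurableSet] with x hx hxΩ using hx hxΩ
  have hp0' : p = 0 := (Lp.eq_zero_iff_ae_eq_zero).2 hu
  have hq0' : q = 0 := (Lp.eq_zero_iff_ae_eq_zero).2 hq'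
  exact Subtype.ext (Prod.ext hp0' hq0')

/-! ### The bilinear forms -/

lemma memLp_grad (u : P.V) : MemLp (grad u) 2 (volume.restrict P.Ω) := Lp.memLp u.1.2

lemma grad_add_ae (u v : P.V) :
    ∀ᵐ x ∂(volume.restrict P.Ω), grad (u + v) x = grad u x + grad v x :=
  Lp.coeFn_add u.1.2 v.1.2

lemma grad_smul_ae (c : ℝ) (u : P.V) :
    ∀ᵐ x ∂(volume.restrict P.Ω), grad (c • u) x = c • grad u x :=
  Lp.coeFn_smul c u.1.2

/-- A pointwise family of bilinear forms in the gradients integrates to a bilinear form. -/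
lemma exists_bilin_integral (B : E d → E d →ₗ[ℝ] E d →ₗ[ℝ] ℝ)
    (hB : ∀ u v : P.V, Integrable (fun x => B x (grad u x) (grad v x)) (volume.restrict P.Ω)) :
    ∃ β : P.V →ₗ[ℝ] P.V →ₗ[ℝ] ℝ, ∀ u v, β u v = ∫ x in P.Ω, B x (grad u x) (grad v x) := by
  refine ⟨LinearMap.mk₂ ℝ (fun u v => ∫ x in P.Ω, B x (grad u x) (grad v x)) ?_ ?_ ?_ ?_,
    fun u v => rfl⟩
  · intro u u' v
    rw [← integral_add (hB _ _) (hB _ _)]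
    refine integral_congr_ae ?_
    filter_upwards [grad_add_ae u u'] with x hx
    simp [hx]
  · intro c u v
    rw [← integral_smul]
    refine integral_congr_ae ?_
    filter_upwards [grad_smul_ae c u] with x hx
    simp [hx]
  · intro u v v'
    rw [← integral_add (hB _ _) (hB _ _)]
    refine integral_congr_ae ?_
    filter_upwards [grad_add_ae v v'] with x hx
    simp [hx]
  · intro c u v
    rw [← integral_smul]
    refine integral_congr_ae ?_
    filter_upwards [grad_smul_ae c v] with x hx
    simp [hx]

lemma bb_mulVec (x v : E d) : P.bb x *ᵥ v.ofLp = (⟪P.b x, v⟫ • P.b x).ofLp := by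
  rw [bb, Matrix.vecMulVec_mulVec, EuclideanSpace.inner_eq_star_dotProduct]
  ext i
  simp [mul_comm, dotProduct_comm]

lemma bb_transpose (x : E d) : (P.bb x)ᵀ = P.bb x := by
  rw [bb, Matrix.transpose_vecMulVec]

/-- The component of `v` orthogonal to `b`. -/
noncomputable def perp (P : Problem d) (x v : E d) : E d := v - ⟪P.b x, v⟫ • P.b x

lemma one_sub_bb_mulVec (x v : E d) : (1 - P.bb x) *ᵥ v.ofLp = (P.perp x v).ofLp := by
  rw [Matrix.sub_mulVec, Matrix.one_mulVec, bb_mulVec]; rfl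

lemma inner_perp {x : E d} (hx : ‖P.b x‖ = 1) (v : E d) : ⟪P.perp x v, P.b x⟫ = 0 := by
  rw [perp, inner_sub_left, real_inner_smul_left, real_inner_self_eq_norm_sq, hx,
    real_inner_comm]
  ring

lemma norm_sq_eq {x : E d} (hx : ‖P.b x‖ = 1) (v : E d) :
    ‖v‖ ^ 2 = ⟪P.b x, v⟫ ^ 2 + ‖P.perp x v‖ ^ 2 := by
  have h : v = ⟪P.b x, v⟫ • P.b x + P.perp x v := by simp [perp]
  have h1 := norm_add_sq_real (⟪P.b x, v⟫ • P.b x) (P.perp x v)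
  rw [← h, norm_smul, hx, real_inner_smul_left, real_inner_comm (P.perp x v),
    inner_perp hx] at h1
  simpa using h1

/-- Both projectors are symmetric, so the outer one moves to the other factor and `A` decouples
along `b` and its orthogonal complement. Coercivity and `a_∥ ≤ a` are read off from this splitting.
-/
lemma A_mulVec_dotProduct {x : E d} (hx : ‖P.b x‖ = 1) (v w : E d) :
    (P.A x *ᵥ v.ofLp) ⬝ᵥ w.ofLp = P.Apar x * (⟪P.b x, v⟫ * ⟪P.b x, w⟫) +
      (P.Aperp x *ᵥ (P.perp x v).ofLp) ⬝ᵥ (P.perp x w).ofLp := by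
  have key : ∀ (M : Matrix (Fin d) (Fin d) ℝ), Mᵀ = M → ∀ y z : Fin d → ℝ,
      (M *ᵥ y) ⬝ᵥ z = y ⬝ᵥ (M *ᵥ z) := fun M hM y z => by
    rw [Matrix.dotProduct_mulVec, ← Matrix.mulVec_transpose, hM]
  have hdot : ∀ y z : E d, y.ofLp ⬝ᵥ z.ofLp = ⟪y, z⟫ := fun y z => by
    rw [EuclideanSpace.inner_eq_star_dotProduct, dotProduct_comm]; simp
  rw [A, Matrix.add_mulVec, add_dotProduct]
  congr 1
  · rw [← Matrix.mulVec_mulVec, ← Matrix.mulVec_mulVec, key _ (bb_transpose x), bb_mulVec,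
      bb_mulVec, Matrix.smul_mulVec, Matrix.one_mulVec, smul_dotProduct, hdot,
      real_inner_smul_left, real_inner_smul_right, real_inner_self_eq_norm_sq, hx]
    simp
  · rw [← Matrix.mulVec_mulVec, ← Matrix.mulVec_mulVec, key (1 - P.bb x) (by
      rw [Matrix.transpose_sub, bb_transpose, Matrix.transpose_one]), one_sub_bb_mulVec,
      one_sub_bb_mulVec]

lemma inner_gradPar {x : E d} (hx : ‖P.b x‖ = 1) (u v : P.V) :
    ⟪gradPar u x, gradPar v x⟫ = ⟪P.b x, grad u x⟫ * ⟪P.b x, grad v x⟫ := by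
  rw [gradPar, gradPar, real_inner_smul_left, real_inner_smul_right,
    real_inner_self_eq_norm_sq, hx]
  ring

lemma HypothesisA.ae_norm_b (hP : P.HypothesisA) :
    ∀ᵐ x ∂(volume.restrict P.Ω), ‖P.b x‖ = 1 := by
  filter_upwards [ae_restrict_mem hP.isOpen.measurableSet] with x hx using hP.b_unit x hx

lemma HypothesisA.aemeasurable_b (hP : P.HypothesisA) :
    AEMeasurable P.b (volume.restrict P.Ω) :=
  ((hP.b_continuous.mono subset_closure).aestronglyMeasurable hP.isOpen.measurableSet).aemeasurable

/-- The symmetric bilinear form of `A` is bounded and coercive, almost everywhere. -/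
lemma HypothesisA.exists_bounds (hP : P.HypothesisA) : ∃ A₀ A₁ : ℝ, 0 < A₀ ∧
    ∀ᵐ x ∂(volume.restrict P.Ω), A₀ ≤ P.Apar x ∧ P.Apar x ≤ A₁ ∧
      (∀ v : E d, A₀ * ‖v‖ ^ 2 ≤ (P.A x *ᵥ v.ofLp) ⬝ᵥ v.ofLp) ∧
      (∀ v : E d, P.Apar x * ⟪P.b x, v⟫ ^ 2 ≤ (P.A x *ᵥ v.ofLp) ⬝ᵥ v.ofLp) ∧
      (∀ v w : E d, (P.A x *ᵥ v.ofLp) ⬝ᵥ w.ofLp = (P.A x *ᵥ w.ofLp) ⬝ᵥ v.ofLp) ∧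
      (∀ v w : E d, |(P.A x *ᵥ v.ofLp) ⬝ᵥ w.ofLp| ≤ A₁ * (‖v‖ ^ 2 + ‖w‖ ^ 2)) := by
  obtain ⟨A₀, A₁, h0, h01, hpar, hperp⟩ := hP.bounds
  refine ⟨A₀, A₁, h0, ?_⟩
  filter_upwards [hpar, hperp, hP.A_symm, hP.ae_norm_b] with x h1 h2 h3 hb
  have hq : ∀ v : E d, (P.A x *ᵥ v.ofLp) ⬝ᵥ v.ofLp = P.Apar x * ⟪P.b x, v⟫ ^ 2 +
      (P.perp x v).ofLp ⬝ᵥ (P.Aperp x *ᵥ (P.perp x v).ofLp) := fun v => by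
    rw [A_mulVec_dotProduct hb, dotProduct_comm (P.perp x v).ofLp, sq]
  have hlow : ∀ v : E d, A₀ * ‖v‖ ^ 2 ≤ (P.A x *ᵥ v.ofLp) ⬝ᵥ v.ofLp := fun v => by
    rw [hq, norm_sq_eq hb v]
    have := (h2 _ (inner_perp hb v)).1
    have := mul_le_mul_of_nonneg_right h1.1 (sq_nonneg ⟪P.b x, v⟫)
    linarith
  have hup : ∀ v : E d, (P.A x *ᵥ v.ofLp) ⬝ᵥ v.ofLp ≤ A₁ * ‖v‖ ^ 2 := fun v => by
    rw [hq, norm_sq_eq hb v]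
    have := (h2 _ (inner_perp hb v)).2
    have := mul_le_mul_of_nonneg_right h1.2 (sq_nonneg ⟪P.b x, v⟫)
    linarith
  have hsym : ∀ v w : E d, (P.A x *ᵥ v.ofLp) ⬝ᵥ w.ofLp = (P.A x *ᵥ w.ofLp) ⬝ᵥ v.ofLp :=
    fun v w => by
      rw [dotProduct_comm (P.A x *ᵥ w.ofLp), Matrix.dotProduct_mulVec, ← Matrix.mulVec_transpose,
        h3.eq]
  have hnn : ∀ v : E d, 0 ≤ (P.A x *ᵥ v.ofLp) ⬝ᵥ v.ofLp := fun v =>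
    (by positivity : 0 ≤ A₀ * ‖v‖ ^ 2).trans (hlow v)
  refine ⟨h1.1, h1.2, hlow, fun v => ?_, hsym, fun v w => ?_⟩
  · rw [hq]
    have := (h2 _ (inner_perp hb v)).1
    have : 0 ≤ A₀ * ‖P.perp x v‖ ^ 2 := by positivity
    linarith
  -- The hypotheses bound only quadratic forms, and `A_⊥` itself may be unbounded. Nonnegativity at
  -- `v ± w` together with the symmetry of `A` bounds the off-diagonal values.
  · have e1 := hnn (v + w)
    have e2 := hnn (v - w)
    have h3 := hup v
    have h4 := hup w
    have h5 := hsym v w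
    rw [WithLp.ofLp_add, Matrix.mulVec_add, add_dotProduct, dotProduct_add, dotProduct_add] at e1
    rw [WithLp.ofLp_sub, Matrix.mulVec_sub, sub_dotProduct, dotProduct_sub, dotProduct_sub] at e2
    have := hnn v
    have := hnn w
    rw [abs_le]
    constructor <;> linarith

lemma integrable_a (hP : P.HypothesisA) (u v : P.V) :
    Integrable (fun x => (P.A x *ᵥ (grad u x).ofLp) ⬝ᵥ (grad v x).ofLp)
      (volume.restrict P.Ω) := by
  obtain ⟨A₀, A₁, -, hA⟩ := hP.exists_bounds
  have hb := hP.aemeasurable_b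
  have h1 := hP.Apar_measurable
  have h2 := hP.Aperp_measurable
  have hu : AEMeasurable (grad u) (volume.restrict P.Ω) := (memLp_grad u).1.aemeasurable
  have hv : AEMeasurable (grad v) (volume.restrict P.Ω) := (memLp_grad v).1.aemeasurable
  have hm : AEMeasurable (fun x => P.Apar x * (⟪P.b x, grad u x⟫ * ⟪P.b x, grad v x⟫) +
      (P.Aperp x *ᵥ (P.perp x (grad u x)).ofLp) ⬝ᵥ (P.perp x (grad v x)).ofLp)
      (volume.restrict P.Ω) := by
    have hpm : ∀ {f : E d → E d}, AEMeasurable f (volume.restrict P.Ω) →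
        AEMeasurable (fun x => P.perp x (f x)) (volume.restrict P.Ω) := fun {f} hf =>
      hf.sub (AEMeasurable.smul (f := fun x => ⟪P.b x, f x⟫) (hb.inner hf) hb)
    have hcoord : ∀ {f : E d → E d}, AEMeasurable f (volume.restrict P.Ω) → ∀ i,
        AEMeasurable (fun x => (f x).ofLp i) (volume.restrict P.Ω) := fun hf i =>
      (EuclideanSpace.proj (𝕜 := ℝ) i).continuous.measurable.comp_aemeasurable hf
    refine (h1.mul ((hb.inner hu).mul (hb.inner hv))).add ?_
    simp only [dotProduct, Matrix.mulVec]
    exact Finset.aemeasurable_fun_sum _ fun i _ => (Finset.aemeasurable_fun_sum _ fun j _ =>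
      (h2 i j).mul (hcoord (hpm hu) j)).mul (hcoord (hpm hv) i)
  have hi : Integrable (fun x => A₁ * (‖grad u x‖ ^ 2 + ‖grad v x‖ ^ 2)) (volume.restrict P.Ω) :=
    (((memLp_grad u).integrable_norm_pow (by norm_num)).add
      ((memLp_grad v).integrable_norm_pow (by norm_num))).const_mul A₁
  refine hi.mono' (hm.congr ?_).aestronglyMeasurable ?_
  · filter_upwards [hP.ae_norm_b] with x hx
    rw [A_mulVec_dotProduct hx]
  · filter_upwards [hA] with x hx
    exact hx.2.2.2.2.2 _ _

lemma integrable_aPar (hP : P.HypothesisA) (u v : P.V) :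
    Integrable (fun x => P.Apar x * (⟪P.b x, grad u x⟫ * ⟪P.b x, grad v x⟫))
      (volume.restrict P.Ω) := by
  obtain ⟨A₀, A₁, h0, hA⟩ := hP.exists_bounds
  have hb := hP.aemeasurable_b
  have hu : AEMeasurable (grad u) (volume.restrict P.Ω) := (memLp_grad u).1.aemeasurable
  have hv : AEMeasurable (grad v) (volume.restrict P.Ω) := (memLp_grad v).1.aemeasurable
  have hi : Integrable (fun x => A₁ * (‖grad u x‖ ^ 2 + ‖grad v x‖ ^ 2)) (volume.restrict P.Ω) :=
    (((memLp_grad u).integrable_norm_pow (by norm_num)).add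
      ((memLp_grad v).integrable_norm_pow (by norm_num))).const_mul A₁
  refine hi.mono' (hP.Apar_measurable.mul ((hb.inner hu).mul (hb.inner hv))).aestronglyMeasurable ?_
  filter_upwards [hA, hP.ae_norm_b] with x hx hbx
  have h1 : |⟪P.b x, grad u x⟫| ≤ ‖grad u x‖ := by
    simpa [hbx] using abs_real_inner_le_norm (P.b x) (grad u x)
  have h2 : |⟪P.b x, grad v x⟫| ≤ ‖grad v x‖ := by
    simpa [hbx] using abs_real_inner_le_norm (P.b x) (grad v x)
  have hpos : 0 ≤ P.Apar x := h0.le.trans hx.1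
  rw [Real.norm_eq_abs, abs_mul, abs_mul, abs_of_nonneg hpos]
  have h3 : |⟪P.b x, grad u x⟫| * |⟪P.b x, grad v x⟫| ≤ ‖grad u x‖ ^ 2 + ‖grad v x‖ ^ 2 := by
    have := mul_le_mul h1 h2 (abs_nonneg _) (norm_nonneg _)
    nlinarith [sq_nonneg (‖grad u x‖ - ‖grad v x‖), sq_nonneg ‖grad u x‖, sq_nonneg ‖grad v x‖]
  exact mul_le_mul hx.2.1 h3 (by positivity) (hpos.trans hx.2.1)

lemma aPar_eq (hP : P.HypothesisA) (u v : P.V) :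
    aPar u v = ∫ x in P.Ω, P.Apar x * (⟪P.b x, grad u x⟫ * ⟪P.b x, grad v x⟫) := by
  refine integral_congr_ae ?_
  filter_upwards [hP.ae_norm_b] with x hx
  rw [inner_gradPar hx]

lemma exists_bilin_a (hP : P.HypothesisA) :
    ∃ β : P.V →ₗ[ℝ] P.V →ₗ[ℝ] ℝ, ∀ u v, β u v = a u v :=
  exists_bilin_integral (fun x => LinearMap.mk₂ ℝ (fun v w => (P.A x *ᵥ v.ofLp) ⬝ᵥ w.ofLp)
    (fun v v' w => by simp [Matrix.mulVec_add]) (fun c v w => by simp [Matrix.mulVec_smul])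
    (fun v w w' => by simp) (fun c v w => by simp)) (integrable_a hP)

lemma exists_bilin_aPar (hP : P.HypothesisA) :
    ∃ β : P.V →ₗ[ℝ] P.V →ₗ[ℝ] ℝ, ∀ u v, β u v = aPar u v := by
  obtain ⟨β, hβ⟩ := exists_bilin_integral (P := P) (fun x => LinearMap.mk₂ ℝ
    (fun v w => P.Apar x * (⟪P.b x, v⟫ * ⟪P.b x, w⟫))
    (fun v v' w => by rw [inner_add_right]; ring)
    (fun c v w => by rw [real_inner_smul_right, smul_eq_mul]; ring)
    (fun v w w' => by rw [inner_add_right]; ring)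
    (fun c v w => by rw [real_inner_smul_right, smul_eq_mul]; ring)) (integrable_aPar hP)
  exact ⟨β, fun u v => (hβ u v).trans (aPar_eq hP u v).symm⟩

lemma l2_eq_inner (u v : P.V) : l2 u v = ⟪v.1.1, u.1.1⟫ := by
  rw [L2.inner_def]; rfl

lemma exists_bilin_l2 : ∃ β : P.V →ₗ[ℝ] P.V →ₗ[ℝ] ℝ, ∀ u v, β u v = l2 u v :=
  ⟨LinearMap.mk₂ ℝ l2
    (fun u u' v => by simp [l2_eq_inner, inner_add_right])
    (fun c u v => by simp [l2_eq_inner, real_inner_smul_right])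
    (fun u v v' => by simp [l2_eq_inner, inner_add_left])
    (fun c u v => by simp [l2_eq_inner, real_inner_smul_left]), fun _ _ => rfl⟩

lemma a_comm (hP : P.HypothesisA) (u v : P.V) : a u v = a v u := by
  obtain ⟨A₀, A₁, -, hA⟩ := hP.exists_bounds
  refine integral_congr_ae ?_
  filter_upwards [hA] with x hx
  exact hx.2.2.2.2.1 _ _

lemma aPar_comm (u v : P.V) : aPar u v = aPar v u := by
  simp only [aPar, real_inner_comm]

lemma aPar_self_nonneg (hP : P.HypothesisA) (u : P.V) : 0 ≤ aPar u u := by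
  obtain ⟨A₀, A₁, h0, hA⟩ := hP.exists_bounds
  rw [aPar_eq hP]
  refine integral_nonneg_of_ae ?_
  filter_upwards [hA] with x hx
  exact mul_nonneg (h0.le.trans hx.1) (mul_self_nonneg _)

lemma aPar_self_le (hP : P.HypothesisA) (u : P.V) : aPar u u ≤ a u u := by
  obtain ⟨A₀, A₁, h0, hA⟩ := hP.exists_bounds
  rw [aPar_eq hP]
  refine integral_mono_ae (integrable_aPar hP u u) (integrable_a hP u u) ?_
  filter_upwards [hA] with x hx
  change P.Apar x * (_ * _) ≤ _
  rw [← sq]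
  exact hx.2.2.2.1 _

lemma eq_zero_of_a_self (hd : d ≠ 0) (hP : P.HypothesisA) {u : P.V} (h : a u u = 0) : u = 0 := by
  obtain ⟨A₀, A₁, h0, hA⟩ := hP.exists_bounds
  refine eq_zero_of_grad_ae_eq_zero hd hP ?_
  have hnn : 0 ≤ᵐ[volume.restrict P.Ω]
      fun x => (P.A x *ᵥ (grad u x).ofLp) ⬝ᵥ (grad u x).ofLp := by
    filter_upwards [hA] with x hx
    exact (by positivity : (0 : ℝ) ≤ A₀ * ‖grad u x‖ ^ 2).trans (hx.2.2.1 _)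
  filter_upwards [(integral_eq_zero_iff_of_nonneg_ae hnn (integrable_a hP u u)).1 h, hA]
    with x hx hAx
  have := hAx.2.2.1 (grad u x)
  rw [hx, Pi.zero_apply] at this
  have h1 : ‖grad u x‖ ^ 2 = 0 :=
    le_antisymm (nonpos_of_mul_nonpos_right this h0) (sq_nonneg _)
  simpa using h1

/-- Since `A_∥ ≥ A₀ > 0`, the space `G_h` is the kernel of the form `a_∥` on `V_h`; this lets `A_h`
be described by bilinear forms alone. -/
lemma aPar_self_eq_zero_iff (hP : P.HypothesisA) (u : P.V) :
    aPar u u = 0 ↔ ∀ᵐ x ∂(volume.restrict P.Ω), gradPar u x = 0 := by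
  obtain ⟨A₀, A₁, h0, hA⟩ := hP.exists_bounds
  constructor
  · intro h
    rw [aPar_eq hP] at h
    have hnn : 0 ≤ᵐ[volume.restrict P.Ω]
        fun x => P.Apar x * (⟪P.b x, grad u x⟫ * ⟪P.b x, grad u x⟫) := by
      filter_upwards [hA] with x hx
      exact mul_nonneg (h0.le.trans hx.1) (mul_self_nonneg _)
    filter_upwards [(integral_eq_zero_iff_of_nonneg_ae hnn (integrable_aPar hP u u)).1 h, hA]
      with x hx hAx
    have hne : P.Apar x ≠ 0 := (h0.trans_le hAx.1).ne'
    have h1 : ⟪P.b x, grad u x⟫ = 0 := by simpa [hne] using hx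
    rw [gradPar, h1, zero_smul]
  · intro h
    refine integral_eq_zero_of_ae ?_
    filter_upwards [h] with x hx
    simp [hx]

lemma l2_self_nonneg (u : P.V) : 0 ≤ l2 u u := by
  rw [l2_eq_inner]; exact real_inner_self_nonneg

lemma eq_zero_of_l2_self (hP : P.HypothesisA) {u : P.V} (h : l2 u u = 0) : u = 0 := by
  rw [l2_eq_inner, inner_self_eq_zero] at h
  refine eq_zero_of_val_ae_eq_zero hP ?_
  have h1 : (u.1.1 : E d → ℝ) =ᵐ[volume.restrict P.Ω] 0 := by
    rw [h]; exact Lp.coeFn_zero _ _ _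
  exact h1

end Problem

/-! ### The abstract saddle point problem -/

section Abstract

variable {H : Type*} [AddCommGroup H] [Module ℝ H]

lemma sq_apply_le_mul (π : H →ₗ[ℝ] H →ₗ[ℝ] ℝ) (hπs : ∀ u v, π u v = π v u)
    (hπ0 : ∀ u, 0 ≤ π u u) (u v : H) : π u v ^ 2 ≤ π u u * π v v := by
  have := LinearMap.BilinForm.apply_mul_apply_le_of_forall_zero_le π hπ0 u v
  rwa [hπs v u, ← sq] at this

/-- Energy argument for uniqueness in the saddle point problem. -/
lemma homogeneous_eq_zero {α π μ : H →ₗ[ℝ] H →ₗ[ℝ] ℝ} (hα : ∀ u, α u u = 0 → u = 0)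
    (hπs : ∀ u v, π u v = π v u) (hπ0 : ∀ u, 0 ≤ π u u) (hπα : ∀ u, π u u ≤ α u u)
    (hμ0 : ∀ u, 0 ≤ μ u u) {ε σ : ℝ} (hε : 0 ≤ ε) (hσ : 0 ≤ σ) {u ξ : H}
    (h1 : ∀ v, α u v + (1 - ε) * π ξ v = 0)
    (h2 : π u ξ - ε * π ξ ξ - σ * μ ξ ξ = 0) : u = 0 ∧ π ξ ξ = 0 ∧ σ * μ ξ ξ = 0 := by
  have hcs := sq_apply_le_mul π hπs hπ0 ξ u
  have hs := hπ0 ξ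
  have hx0 := (hπ0 u).trans (hπα u)
  have ht : 0 ≤ σ * μ ξ ξ := mul_nonneg hσ (hμ0 ξ)
  have hq : π ξ u = ε * π ξ ξ + σ * μ ξ ξ := by rw [hπs ξ u]; linarith
  have hεs : 0 ≤ ε * π ξ ξ := mul_nonneg hε hs
  have hu : u = 0 := by
    refine hα u (le_antisymm ?_ hx0)
    have e := h1 u
    rcases le_total ε 1 with h | h
    · have : 0 ≤ (1 - ε) * π ξ u := mul_nonneg (sub_nonneg.2 h) (by linarith)
      linarith
    -- For `ε > 1` the coupling term has the wrong sign. Cauchy-Schwarz and `ε π(ξ,ξ) ≤ π(ξ,u)` give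
    -- `ε π(ξ,u) ≤ α(u,u)`, while the first equation says `α(u,u) = (ε - 1) π(ξ,u)`.
    · by_contra hne
      rw [not_le] at hne
      have hq0 : 0 < π ξ u := by
        by_contra hq0
        have : π ξ u = 0 := by linarith
        rw [this] at e
        linarith
      have k1 : π ξ ξ * π u u ≤ π ξ ξ * α u u := mul_le_mul_of_nonneg_left (hπα u) hs
      have k2 : ε * π ξ u ^ 2 ≤ (ε * π ξ ξ) * α u u := by
        rw [mul_assoc]
        exact mul_le_mul_of_nonneg_left (hcs.trans k1) hε
      have k3 : (ε * π ξ ξ) * α u u ≤ π ξ u * α u u :=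
        mul_le_mul_of_nonneg_right (by linarith) hx0
      have k4 : π ξ u * (ε * π ξ u) ≤ π ξ u * α u u := by linarith [k2.trans k3]
      have k5 := le_of_mul_le_mul_left k4 hq0
      linarith
  subst hu
  rw [map_zero] at hq
  -- The first equation now gives `(1 - ε) π(ξ,ξ) = 0`, which is void at `ε = 1`; the second gives
  -- `ε π(ξ,ξ) = 0`. Their sum settles every `ε`.
  have h3 := h1 ξ
  rw [map_zero, LinearMap.zero_apply, zero_add] at h3
  have h4 : π ξ ξ = 0 := by
    have : ε * π ξ ξ = 0 := by linarith
    linarith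
  exact ⟨rfl, h4, by linarith⟩

/-- The orthogonal complement, with respect to `μ`, of the kernel of `π`. -/
def kernelComplement (π μ : H →ₗ[ℝ] H →ₗ[ℝ] ℝ) : Submodule ℝ H where
  carrier := {ξ | ∀ w, π w w = 0 → μ ξ w = 0}
  zero_mem' := fun w _ => by simp
  add_mem' := fun h k w hw => by simp [h w hw, k w hw]
  smul_mem' := fun c _ h w hw => by simp [h w hw]

/-- The mixed problem with multiplier space `W`. -/
def MixedSystem (α π μ : H →ₗ[ℝ] H →ₗ[ℝ] ℝ) (W : Submodule ℝ H) (f : H →ₗ[ℝ] ℝ) (q : ℝ × ℝ)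
    (x : H × H) : Prop :=
  x.2 ∈ W ∧ (∀ v, α x.1 v + (1 - q.1) * π x.2 v = f v) ∧
    ∀ w ∈ W, π x.1 w - q.1 * π x.2 w - q.2 * μ x.2 w = 0

/-- Testing with `w` in the kernel of `π` removes both `π` terms by Cauchy-Schwarz and leaves `σ
μ(ξ,w) = 0`. Stabilization thus selects the multiplier in the complement by itself. -/
lemma MixedSystem.mem_kernelComplement {α π μ : H →ₗ[ℝ] H →ₗ[ℝ] ℝ}
    (hπs : ∀ u v, π u v = π v u) (hπ0 : ∀ u, 0 ≤ π u u) {f : H →ₗ[ℝ] ℝ} {q : ℝ × ℝ}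
    (hq : 0 < q.2) {x : H × H} (hx : MixedSystem α π μ ⊤ f q x) :
    x.2 ∈ kernelComplement π μ := by
  intro w hw
  have h0 : ∀ u, π u w = 0 := fun u => by
    have := sq_apply_le_mul π hπs hπ0 u w
    rw [hw, mul_zero] at this
    exact pow_eq_zero_iff two_ne_zero |>.1 (le_antisymm this (sq_nonneg _))
  have := hx.2.2 w trivial
  rw [h0, h0] at this
  have h1 : q.2 * μ x.2 w = 0 := by linarith
  exact (mul_eq_zero.1 h1).resolve_left hq.ne'

end Abstract

/-! ### Continuity in the parameters and compactness -/

/-- Where the homogeneous problem has only the trivial solution, the mixed problem is uniquely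
solvable and its solution depends continuously on the parameters. -/
lemma exists_continuous_solution {H : Type*} [NormedAddCommGroup H] [NormedSpace ℝ H]
    [FiniteDimensional ℝ H] (α π μ : H →ₗ[ℝ] H →ₗ[ℝ] ℝ) (W : Submodule ℝ H) (f : H →ₗ[ℝ] ℝ)
    {D : Set (ℝ × ℝ)} (hD : ∀ q ∈ D, ∀ x, MixedSystem α π μ W 0 q x → x = 0) :
    ∃ U : ℝ × ℝ → H × H, ∀ q ∈ D, (∀ x, MixedSystem α π μ W f q x ↔ x = U q) ∧
      ContinuousAt U q := by
  let X := H × W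
  let Y := (H →ₗ[ℝ] ℝ) × (W →ₗ[ℝ] ℝ)
  let T₀ : X →ₗ[ℝ] Y := ((α ∘ₗ LinearMap.fst ℝ H W) +
      (π ∘ₗ W.subtype ∘ₗ LinearMap.snd ℝ H W)).prod
    (W.subtype.dualMap ∘ₗ π ∘ₗ LinearMap.fst ℝ H W)
  let T₁ : X →ₗ[ℝ] Y := -(π ∘ₗ W.subtype ∘ₗ LinearMap.snd ℝ H W).prod
    (W.subtype.dualMap ∘ₗ π ∘ₗ W.subtype ∘ₗ LinearMap.snd ℝ H W)
  let T₂ : X →ₗ[ℝ] Y := -(0 : X →ₗ[ℝ] (H →ₗ[ℝ] ℝ)).prod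
    (W.subtype.dualMap ∘ₗ μ ∘ₗ W.subtype ∘ₗ LinearMap.snd ℝ H W)
  have hfin : Module.finrank ℝ Y = Module.finrank ℝ X := by
    change Module.finrank ℝ (Module.Dual ℝ H × Module.Dual ℝ W) = Module.finrank ℝ (H × W)
    rw [Module.finrank_prod, Module.finrank_prod, Subspace.dual_finrank_eq,
      Subspace.dual_finrank_eq]
  -- Identifying the target with the source turns the system into an endomorphism affine in `q`,
  -- hence an element of a Banach algebra, where inversion is continuous at units.
  obtain ⟨e⟩ : Nonempty (Y ≃ₗ[ℝ] X) :=
    FiniteDimensional.nonempty_linearEquiv_of_finrank_eq hfin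
  let S : ℝ × ℝ → (X →L[ℝ] X) := fun q =>
    LinearMap.toContinuousLinearMap (e.toLinearMap ∘ₗ T₀) +
      q.1 • LinearMap.toContinuousLinearMap (e.toLinearMap ∘ₗ T₁) +
      q.2 • LinearMap.toContinuousLinearMap (e.toLinearMap ∘ₗ T₂)
  have hSc : Continuous S := by fun_prop
  have hS : ∀ q y, S q y = e (T₀ y + q.1 • T₁ y + q.2 • T₂ y) := fun q y => by
    simp [S]
  have hsys : ∀ (g : H →ₗ[ℝ] ℝ) q (y : X),
      MixedSystem α π μ W g q (y.1, (y.2 : H)) ↔ S q y = e (g, 0) := by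
    intro g q y
    rw [hS, e.injective.eq_iff, Prod.ext_iff, LinearMap.ext_iff, LinearMap.ext_iff]
    simp only [MixedSystem, SetLike.coe_mem, true_and]
    refine and_congr (forall_congr' fun v => ?_) ?_
    · have : (T₀ y + q.1 • T₁ y + q.2 • T₂ y).1 v = α y.1 v + (1 - q.1) * π y.2 v := by
        change α y.1 v + π y.2 v + q.1 * -(π y.2 v) + q.2 * -0 = _
        ring
      rw [this]
    · rw [Subtype.forall]
      refine forall_congr' fun w => forall_congr' fun hw => ?_
      have : (T₀ y + q.1 • T₁ y + q.2 • T₂ y).2 ⟨w, hw⟩ =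
          π y.1 w - q.1 * π y.2 w - q.2 * μ y.2 w := by
        change π y.1 w + q.1 * -(π y.2 w) + q.2 * -(μ y.2 w) = _
        ring
      rw [this]; rfl
  have hunit : ∀ q ∈ D, IsUnit (S q) := by
    intro q hq
    have hinj : Function.Injective (S q).toLinearMap := by
      rw [← LinearMap.ker_eq_bot, LinearMap.ker_eq_bot']
      intro y hy
      have h0 : MixedSystem α π μ W 0 q (y.1, (y.2 : H)) := by
        rw [hsys]
        refine hy.trans ?_
        rw [← Prod.zero_eq_mk, map_zero]
      have := hD q hq _ h0
      rw [Prod.mk_eq_zero] at this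
      exact Prod.ext this.1 (Subtype.ext this.2)
    rw [ContinuousLinearMap.isUnit_iff_bijective]
    exact ⟨hinj, LinearMap.injective_iff_surjective.1 hinj⟩
  let ι : X →L[ℝ] H × H := (ContinuousLinearMap.id ℝ H).prodMap W.subtypeL
  -- `Ring.inverse` is total (zero off the units), so `U` is defined for all `q` and is continuous
  -- in a two-sided sense even at boundary points of `D`.
  refine ⟨fun q => ι (Ring.inverse (S q) (e (f, 0))), fun q hq => ⟨fun x => ?_, ?_⟩⟩
  · have hu := hunit q hq
    have hinv1 : ∀ y, Ring.inverse (S q) (S q y) = y := fun y =>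
      congrArg (fun L : X →L[ℝ] X => L y) (Ring.inverse_mul_cancel _ hu)
    have hinv2 : ∀ y, S q (Ring.inverse (S q) y) = y := fun y =>
      congrArg (fun L : X →L[ℝ] X => L y) (Ring.mul_inverse_cancel _ hu)
    constructor
    · intro hx
      have h1 : S q (x.1, ⟨x.2, hx.1⟩) = e (f, 0) := (hsys f q (x.1, ⟨x.2, hx.1⟩)).1 hx
      change x = ι (Ring.inverse (S q) (e (f, 0)))
      rw [← h1, hinv1]
      rfl
    · rintro rfl
      exact (hsys f q (Ring.inverse (S q) (e (f, 0)))).2 (hinv2 _)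
  · obtain ⟨w, hw⟩ := hunit q hq
    have h1 : ContinuousAt (fun q => Ring.inverse (S q)) q := by
      refine ContinuousAt.comp (g := Ring.inverse) ?_ hSc.continuousAt
      rw [← hw]
      exact NormedRing.inverse_continuousAt (R := X →L[ℝ] X) w
    exact ι.continuous.continuousAt.comp (h1.clm_apply continuousAt_const)

/-- The inverse is the adjugate over a nonvanishing determinant, so `cond2` is continuous on the
compact set `K`. -/
lemma exists_cond2_le {ι : Type*} [Fintype ι] [DecidableEq ι] {M : ℝ → Matrix ι ι ℝ}
    (hM : Continuous M) {K : Set ℝ} (hK : IsCompact K) (hdet : ∀ t ∈ K, IsUnit (M t).det) :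
    ∃ C : ℝ, ∀ t ∈ K, cond2 (M t) ≤ C := by
  have hT : Continuous (Matrix.toEuclideanCLM (n := ι) (𝕜 := ℝ)) :=
    (Matrix.toEuclideanCLM (n := ι) (𝕜 := ℝ)).toAlgEquiv.toLinearMap.continuous_of_finiteDimensional
  have hinv : ContinuousOn (fun t => (M t)⁻¹) K := by
    simp only [Matrix.inv_def, Ring.inverse_eq_inv']
    exact (hM.matrix_det.continuousOn.inv₀ fun t ht => (hdet t ht).ne_zero).smul
      hM.matrix_adjugate.continuousOn
  have hc : ContinuousOn (fun t => cond2 (M t)) K :=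
    (hT.comp hM).norm.continuousOn.mul (hT.comp_continuousOn hinv).norm
  obtain ⟨C, hC⟩ := hK.exists_bound_of_continuousOn hc
  exact ⟨C, fun t ht => (le_abs_self _).trans (hC t ht)⟩

namespace Problem

variable {P : Problem d}

/-! ### Uniform bound for the solution -/

lemma normV_nonneg (u : P.V) : 0 ≤ normV u := Real.sqrt_nonneg _

lemma normV_sq (hP : P.HypothesisA) (u : P.V) : normV u ^ 2 = a u u :=
  Real.sq_sqrt ((aPar_self_nonneg hP u).trans (aPar_self_le hP u))

lemma dualNorm_nonneg_and_le {f : P.V →ₗ[ℝ] ℝ} (hf : InDual f) :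
    0 ≤ dualNorm f ∧ ∀ v, f v ≤ dualNorm f * normV v := by
  obtain ⟨C, hC⟩ := hf
  have hbdd : BddAbove (range fun v : P.V => f v / normV v) := by
    refine ⟨|C|, ?_⟩
    rintro _ ⟨v, rfl⟩
    refine div_le_of_le_mul₀ (normV_nonneg v) (abs_nonneg C) ?_
    exact (le_abs_self _).trans ((hC v).trans
      (mul_le_mul_of_nonneg_right (le_abs_self C) (normV_nonneg v)))
  refine ⟨by simpa [dualNorm] using le_ciSup hbdd 0, fun v => ?_⟩
  -- If `normV v = 0` the quotient is `0` by convention and says nothing about `f v`; `InDual` gives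
  -- the inequality directly.
  rcases (normV_nonneg v).eq_or_lt with h | h
  · have := hC v
    rw [← h, mul_zero] at this ⊢
    exact (le_abs_self _).trans this
  · exact (div_le_iff₀ h).1 (le_ciSup hbdd v)

/-- The bound `M` also ensures that the real supremum is over a bounded family; nonnegativity comes
from `v = 0`. -/
lemma starNorm_nonneg_and_le {Vh : Submodule ℝ P.V} {ξ : P.V} {M : ℝ} (hM : 0 ≤ M)
    (h : ∀ v ∈ Vh, aPar ξ v ≤ M * normV v) (h0 : aPar ξ 0 = 0) :
    0 ≤ starNorm Vh ξ ∧ starNorm Vh ξ ≤ M := by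
  have hle : ∀ v : Vh, aPar ξ v / normV (v : P.V) ≤ M := fun v =>
    div_le_of_le_mul₀ (normV_nonneg _) hM (h v v.2)
  refine ⟨?_, ciSup_le hle⟩
  have hbdd : BddAbove (range fun v : Vh => aPar ξ v / normV (v : P.V)) := by
    refine ⟨M, ?_⟩
    rintro _ ⟨v, rfl⟩
    exact hle v
  simpa [h0, starNorm] using le_ciSup hbdd 0

lemma aPar_zero_right (hP : P.HypothesisA) (u : P.V) : aPar u 0 = 0 := by
  obtain ⟨π, hπ⟩ := exists_bilin_aPar hP
  rw [← hπ, map_zero]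

lemma aPar_sq_le (hP : P.HypothesisA) (u v : P.V) : aPar u v ^ 2 ≤ aPar u u * aPar v v := by
  obtain ⟨π, hπ⟩ := exists_bilin_aPar hP
  simpa only [hπ] using sq_apply_le_mul π (fun u v => by simp only [hπ, aPar_comm u v])
    (fun u => by simpa only [hπ] using aPar_self_nonneg hP u) u v

lemma neg_a_le (hP : P.HypothesisA) (u v : P.V) : -a u v ≤ normV u * normV v := by
  obtain ⟨α, hα⟩ := exists_bilin_a hP
  have h : a u v ^ 2 ≤ a u u * a v v := by
    simpa only [hα] using sq_apply_le_mul α (fun u v => by simp only [hα, a_comm hP u v])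
      (fun u => by simpa only [hα] using (aPar_self_nonneg hP u).trans (aPar_self_le hP u)) u v
  rw [← normV_sq hP, ← normV_sq hP, ← mul_pow] at h
  exact (neg_le_abs _).trans
    (abs_le_of_sq_le_sq h (mul_nonneg (normV_nonneg u) (normV_nonneg v)))

/-- With `F` the dual norm of `f`, the four squared contributions are `X² ≤ F²`, `|ξ|_{*h}² ≤ 16 F²`
and `T ≤ 2 F²` for the last two together. The sum `19 F²` is below `(5 F)²`. -/
lemma normX_le (hP : P.HypothesisA) {Vh : Submodule ℝ P.V} {f : P.V →ₗ[ℝ] ℝ} (hf : InDual f)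
    {ε σ : ℝ} (hε : ε ∈ Icc (0 : ℝ) 1) (hσ : 0 ≤ σ) {x : P.V × P.V}
    (hx : SolvesScheme f Vh ε σ x) : normX Vh ε σ x ≤ 5 * dualNorm f := by
  obtain ⟨u, ξ⟩ := x
  obtain ⟨hu, hξ, h1, h2⟩ := hx
  obtain ⟨hF, hfF⟩ := dualNorm_nonneg_and_le hf
  change u ∈ Vh at hu
  change ξ ∈ Vh at hξ
  change ∀ v ∈ Vh, a u v + (1 - ε) * aPar ξ v = f v at h1
  change ∀ w ∈ Vh, aPar u w - ε * aPar ξ w - σ * l2 ξ w = 0 at h2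
  set F := dualNorm f
  set X := normV u with hX
  have hX0 : 0 ≤ X := normV_nonneg u
  have hXsq : X ^ 2 = a u u := normV_sq hP u
  have hs := aPar_self_nonneg hP ξ
  have hεs : 0 ≤ ε * aPar ξ ξ := mul_nonneg hε.1 hs
  have hσt : 0 ≤ σ * l2 ξ ξ := mul_nonneg hσ (l2_self_nonneg ξ)
  obtain ⟨T, hT⟩ : ∃ T, T = ε * aPar ξ ξ + σ * l2 ξ ξ := ⟨_, rfl⟩
  have hT0 : 0 ≤ T := by linarith
  have hq : aPar ξ u = T := by
    rw [aPar_comm]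
    linarith [h2 ξ hξ]
  have e1 : X ^ 2 + (1 - ε) * T ≤ F * X := by
    rw [hXsq, ← hq, h1 u hu]
    exact hfF u
  have hT1 : 0 ≤ (1 - ε) * T := mul_nonneg (sub_nonneg.2 hε.2) hT0
  have hXF : X ≤ F := by
    by_contra hlt
    rw [not_le] at hlt
    have := mul_lt_mul_of_pos_right hlt (hF.trans_lt hlt)
    nlinarith
  have hX2 : X ^ 2 ≤ F ^ 2 := pow_le_pow_left₀ hX0 hXF 2
  have key : T ≤ 2 * F ^ 2 ∧ ∀ v ∈ Vh, aPar ξ v ≤ 4 * F * normV v := by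
    -- For `ε ≤ 1/2` the factor `1 - ε ≥ 1/2` can be divided out of both the energy inequality and
    -- the first equation. For `ε ≥ 1/2`, `a_∥(ξ,ξ) ≤ 2 T`, and Cauchy-Schwarz gives `T² ≤ 2 T F²`.
    rcases le_total ε (1 / 2) with h | h
    · constructor
      · have := mul_le_mul_of_nonneg_right (sub_le_sub_left h 1) hT0
        have := mul_le_mul_of_nonneg_left hXF hF
        nlinarith [sq_nonneg X]
      · intro v hv
        rcases le_total (aPar ξ v) 0 with hn | hn
        · exact hn.trans (mul_nonneg (by linarith) (normV_nonneg v))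
        · have := mul_le_mul_of_nonneg_right (sub_le_sub_left h 1) hn
          have := neg_a_le hP u v
          have := mul_le_mul_of_nonneg_right hXF (normV_nonneg v)
          linarith [h1 v hv, hfF v]
    · have hs2 : aPar ξ ξ ≤ 2 * T := by
        have := mul_le_mul_of_nonneg_right h hs
        linarith
      have hT2 : T ≤ 2 * F ^ 2 := by
        by_contra hlt
        rw [not_le] at hlt
        have k1 := aPar_sq_le hP ξ u
        rw [hq] at k1
        have k2 : aPar ξ ξ * aPar u u ≤ 2 * T * F ^ 2 :=
          mul_le_mul hs2 ((aPar_self_le hP u).trans (hXsq.symm.le.trans hX2))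
            (aPar_self_nonneg hP u) (by linarith)
        have hTpos : 0 < T := (by positivity : (0 : ℝ) ≤ 2 * F ^ 2).trans_lt hlt
        have := mul_lt_mul_of_pos_right hlt hTpos
        nlinarith
      refine ⟨hT2, fun v _ => ?_⟩
      have k1 := aPar_sq_le hP ξ v
      have k2 : aPar ξ ξ * aPar v v ≤ 4 * F ^ 2 * normV v ^ 2 := by
        rw [normV_sq hP]
        exact mul_le_mul (by linarith) (aPar_self_le hP v) (aPar_self_nonneg hP v) (by positivity)
      have hnn : 0 ≤ F * normV v := mul_nonneg hF (normV_nonneg v)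
      have k3 : aPar ξ v ≤ 2 * F * normV v := by
        refine (le_abs_self _).trans (abs_le_of_sq_le_sq ((k1.trans k2).trans_eq (by ring)) ?_)
        linarith
      linarith
  obtain ⟨hs0, hs4⟩ := starNorm_nonneg_and_le (by positivity) key.2 (aPar_zero_right hP ξ)
  have hs16 : starNorm Vh ξ ^ 2 ≤ (4 * F) ^ 2 := pow_le_pow_left₀ hs0 hs4 2
  refine Real.sqrt_le_iff.2 ⟨by positivity, ?_⟩
  change X ^ 2 + starNorm Vh ξ ^ 2 + ε * aPar ξ ξ + σ * l2 ξ ξ ≤ _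
  have : 0 ≤ F ^ 2 := sq_nonneg F
  linarith [key.1]

/-! ### The discrete systems as mixed systems -/

section Represents

variable {H : Type*} [AddCommGroup H] [Module ℝ H]

/-- The bilinear forms `α`, `π`, `μ` represent `a`, `a_∥` and the `L²` product on a space `H`
that parametrizes a subspace of `𝒱` by the injective map `j`. -/
structure Represents (j : H →ₗ[ℝ] P.V) (α π μ : H →ₗ[ℝ] H →ₗ[ℝ] ℝ) : Prop where
  injective : Function.Injective j
  apply_a : ∀ u v : H, α u v = a (j u) (j v)
  apply_aPar : ∀ u v : H, π u v = aPar (j u) (j v)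
  apply_l2 : ∀ u v : H, μ u v = l2 (j u) (j v)

lemma exists_represents (hP : P.HypothesisA) {j : H →ₗ[ℝ] P.V} (hj : Function.Injective j) :
    ∃ α π μ : H →ₗ[ℝ] H →ₗ[ℝ] ℝ, Represents j α π μ := by
  obtain ⟨α, hα⟩ := exists_bilin_a hP
  obtain ⟨π, hπ⟩ := exists_bilin_aPar hP
  obtain ⟨μ, hμ⟩ := exists_bilin_l2 (P := P)
  exact ⟨α.compl₁₂ j j, π.compl₁₂ j j, μ.compl₁₂ j j, hj, fun _ _ => hα _ _, fun _ _ => hπ _ _,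
    fun _ _ => hμ _ _⟩

namespace Represents

variable {j : H →ₗ[ℝ] P.V} {α π μ : H →ₗ[ℝ] H →ₗ[ℝ] ℝ}

lemma aPar_comm (h : Represents j α π μ) (u v : H) : π u v = π v u := by
  rw [h.apply_aPar, h.apply_aPar, Problem.aPar_comm]

lemma aPar_nonneg (h : Represents j α π μ) (hP : P.HypothesisA) (u : H) : 0 ≤ π u u := by
  rw [h.apply_aPar]; exact aPar_self_nonneg hP _

lemma eq_zero_of_map (h : Represents j α π μ) {u : H} (hu : j u = 0) : u = 0 :=
  h.injective (hu.trans (map_zero j).symm)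

/-- `hW` isolates the only step that depends on the multiplier space: on the whole space `σ > 0`
yields `μ ξ ξ = 0`, and on the complement `ξ` is orthogonal to itself once it lies in the kernel. -/
lemma eq_zero_of_mixedSystem (h : Represents j α π μ) (hd : d ≠ 0) (hP : P.HypothesisA)
    {W : Submodule ℝ H} {q : ℝ × ℝ} (hq : 0 ≤ q.1 ∧ 0 ≤ q.2)
    (hW : ∀ ξ ∈ W, π ξ ξ = 0 → q.2 * μ ξ ξ = 0 → μ ξ ξ = 0) {x : H × H}
    (hx : MixedSystem α π μ W 0 q x) : x = 0 := by
  have hα : ∀ u, α u u = 0 → u = 0 := fun u hu => by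
    rw [h.apply_a] at hu
    exact h.eq_zero_of_map (eq_zero_of_a_self hd hP hu)
  have hπα : ∀ u, π u u ≤ α u u := fun u => by
    rw [h.apply_aPar, h.apply_a]; exact aPar_self_le hP _
  have hμ0 : ∀ u, 0 ≤ μ u u := fun u => by rw [h.apply_l2]; exact l2_self_nonneg _
  obtain ⟨hu, hπ, hμ⟩ := homogeneous_eq_zero hα h.aPar_comm (h.aPar_nonneg hP) hπα hμ0
    hq.1 hq.2 hx.2.1 (hx.2.2 _ hx.1)
  have hξ := hW _ hx.1 hπ hμ
  rw [h.apply_l2] at hξ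
  exact Prod.ext hu (h.eq_zero_of_map (eq_zero_of_l2_self hP hξ))

lemma eq_zero_of_mixedSystem_top (h : Represents j α π μ) (hd : d ≠ 0) (hP : P.HypothesisA)
    {q : ℝ × ℝ} (hq : 0 ≤ q.1 ∧ 0 < q.2) {x : H × H}
    (hx : MixedSystem α π μ ⊤ 0 q x) : x = 0 :=
  h.eq_zero_of_mixedSystem hd hP ⟨hq.1, hq.2.le⟩
    (fun _ _ _ h0 => (mul_eq_zero.1 h0).resolve_left hq.2.ne') hx

lemma eq_zero_of_mixedSystem_kernelComplement (h : Represents j α π μ) (hd : d ≠ 0)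
    (hP : P.HypothesisA) {q : ℝ × ℝ} (hq : 0 ≤ q.1 ∧ 0 ≤ q.2) {x : H × H}
    (hx : MixedSystem α π μ (kernelComplement π μ) 0 q x) : x = 0 :=
  h.eq_zero_of_mixedSystem (W := kernelComplement π μ) hd hP hq (fun ξ hξ h0 _ => hξ ξ h0) hx

lemma mem_kernelComplement_iff (h : Represents j α π μ) (hP : P.HypothesisA)
    {Vh : Submodule ℝ P.V} (hj : ∀ v, v ∈ Vh ↔ ∃ w, j w = v) (ξ : H) :
    ξ ∈ kernelComplement π μ ↔ j ξ ∈ Ah Vh := by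
  constructor
  · refine fun hξ => ⟨(hj _).2 ⟨ξ, rfl⟩, ?_⟩
    rintro w ⟨hw, hw0⟩
    obtain ⟨w, rfl⟩ := (hj _).1 hw
    have := hξ w (by rw [h.apply_aPar]; exact (aPar_self_eq_zero_iff hP _).2 hw0)
    rwa [h.apply_l2] at this
  · intro hξ w hw
    rw [h.apply_aPar, aPar_self_eq_zero_iff hP] at hw
    rw [h.apply_l2]
    exact hξ.2 (j w) ⟨(hj _).2 ⟨w, rfl⟩, hw⟩

lemma solvesOn_iff (h : Represents j α π μ) {Vh : Submodule ℝ P.V}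
    (hj : ∀ v, v ∈ Vh ↔ ∃ w, j w = v) (f : P.V →ₗ[ℝ] ℝ) {W : Submodule ℝ H}
    {Wh : Set P.V} (hWh : ∀ ξ ∈ Wh, ξ ∈ Vh) (hW : ∀ ξ : H, ξ ∈ W ↔ j ξ ∈ Wh) (ε σ : ℝ)
    (x : P.V × P.V) : SolvesOn f Vh Wh ε σ x ↔
      ∃ y : H × H, MixedSystem α π μ W (f ∘ₗ j) (ε, σ) y ∧ x = (j y.1, j y.2) := by
  constructor
  · rintro ⟨h1, h2, h3, h4⟩
    obtain ⟨u, ξ⟩ := x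
    obtain ⟨u, rfl⟩ := (hj _).1 h1
    obtain ⟨ξ, rfl⟩ := (hj _).1 (hWh _ h2)
    refine ⟨(u, ξ), ⟨(hW _).2 h2, fun v => ?_, fun w hw => ?_⟩, rfl⟩
    · rw [h.apply_a, h.apply_aPar]
      exact h3 _ ((hj _).2 ⟨v, rfl⟩)
    · rw [h.apply_aPar, h.apply_aPar, h.apply_l2]
      exact h4 _ ((hW w).1 hw)
  · rintro ⟨y, ⟨h2, h3, h4⟩, rfl⟩
    refine ⟨(hj _).2 ⟨y.1, rfl⟩, (hW _).1 h2, fun v hv => ?_, fun w hw => ?_⟩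
    · obtain ⟨v, rfl⟩ := (hj _).1 hv
      have := h3 v
      rwa [h.apply_a, h.apply_aPar] at this
    · obtain ⟨w, rfl⟩ := (hj _).1 (hWh _ hw)
      have := h4 w ((hW _).2 hw)
      rwa [h.apply_aPar, h.apply_aPar, h.apply_l2] at this

end Represents

end Represents

/-! ### One continuous solution family for both schemes -/

lemma exists_solution_family_of_parametrization {H : Type*} [NormedAddCommGroup H]
    [NormedSpace ℝ H] [FiniteDimensional ℝ H] (hd : d ≠ 0) (hP : P.HypothesisA)
    {j : H →ₗ[ℝ] P.V} (hinj : Function.Injective j) {Vh : Submodule ℝ P.V}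
    (hj : ∀ v, v ∈ Vh ↔ ∃ w, j w = v) (f : P.V →ₗ[ℝ] ℝ) :
    ∃ U : ℝ × ℝ → P.V × P.V,
      (∀ ε σ : ℝ, 0 ≤ ε → 0 < σ → ∀ x, SolvesScheme f Vh ε σ x ↔ x = U (ε, σ)) ∧
      (∀ ε σ : ℝ, 0 ≤ ε → 0 ≤ σ → (∀ x, SolvesReduced f Vh ε σ x ↔ x = U (ε, σ)) ∧
        ContinuousAt U (ε, σ)) := by
  obtain ⟨α, π, μ, h⟩ := exists_represents hP hinj
  obtain ⟨V, hV⟩ := exists_continuous_solution α π μ (kernelComplement π μ) (f ∘ₗ j)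
    (D := {q | 0 ≤ q.1 ∧ 0 ≤ q.2})
    (fun q hq x hx => h.eq_zero_of_mixedSystem_kernelComplement hd hP hq hx)
  obtain ⟨Z, hZ⟩ := exists_continuous_solution α π μ ⊤ (f ∘ₗ j)
    (D := {q | 0 ≤ q.1 ∧ 0 < q.2})
    (fun q hq x hx => h.eq_zero_of_mixedSystem_top hd hP hq hx)
  -- The stabilized solution lies in the complement and satisfies the reduced equations, so
  -- uniqueness identifies the two families. `V`, unlike `Z`, remains available at `σ = 0`.
  have hZV : ∀ q : ℝ × ℝ, 0 ≤ q.1 → 0 < q.2 → Z q = V q := by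
    intro q h1 h2
    refine ((hV q ⟨h1, h2.le⟩).1 _).1 ?_
    have hz := ((hZ q ⟨h1, h2⟩).1 _).2 rfl
    exact ⟨hz.mem_kernelComplement h.aPar_comm (h.aPar_nonneg hP) h2, hz.2.1,
      fun w _ => hz.2.2 w trivial⟩
  refine ⟨fun q => (j (V q).1, j (V q).2), fun ε σ hε hσ x => ?_,
    fun ε σ hε hσ => ⟨fun x => ?_, ?_⟩⟩
  · rw [SolvesScheme, h.solvesOn_iff hj f (W := ⊤) (Wh := (Vh : Set P.V)) (fun ξ hξ => hξ)
      (fun ξ => ⟨fun _ => (hj _).2 ⟨ξ, rfl⟩, fun _ => trivial⟩)]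
    simp only [(hZ (ε, σ) ⟨hε, hσ⟩).1, exists_eq_left, hZV (ε, σ) hε hσ]
  · rw [SolvesReduced, h.solvesOn_iff hj f (Wh := Ah Vh) (fun ξ hξ => hξ.1) (h.mem_kernelComplement_iff hP hj)]
    simp only [(hV (ε, σ) ⟨hε, hσ⟩).1, exists_eq_left]
  · have hjc : Continuous j := j.continuous_of_finiteDimensional
    have hc : Continuous fun y : H × H => (j y.1, j y.2) := by fun_prop
    exact hc.continuousAt.comp (hV (ε, σ) ⟨hε, hσ⟩).2

lemma nonempty_linearEquiv_fin {H : Type*} [AddCommMonoid H] [Module ℝ H] [Module.Finite ℝ H] :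
    ∃ n : ℕ, Nonempty (H ≃ₗ[ℝ] (Fin n → ℝ)) := by
  let _ := Module.addCommMonoidToAddCommGroup ℝ (M := H)
  exact ⟨_, ⟨(Module.finBasis ℝ H).equivFun⟩⟩

theorem exists_solution_family (hd : d ≠ 0) (hP : P.HypothesisA) (Vh : Submodule ℝ P.V)
    [FiniteDimensional ℝ Vh] (f : P.V →ₗ[ℝ] ℝ) :
    ∃ U : ℝ × ℝ → P.V × P.V,
      (∀ ε σ : ℝ, 0 ≤ ε → 0 < σ → ∀ x, SolvesScheme f Vh ε σ x ↔ x = U (ε, σ)) ∧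
      (∀ ε σ : ℝ, 0 ≤ ε → 0 ≤ σ → (∀ x, SolvesReduced f Vh ε σ x ↔ x = U (ε, σ)) ∧
        ContinuousAt U (ε, σ)) := by
  obtain ⟨n, ⟨e⟩⟩ := nonempty_linearEquiv_fin (H := Vh)
  refine exists_solution_family_of_parametrization hd hP
    (j := Vh.subtype ∘ₗ e.symm.toLinearMap)
    (Subtype.val_injective.comp e.symm.injective) (fun v => ⟨fun hv => ?_, ?_⟩) f
  · exact ⟨e ⟨v, hv⟩, congrArg Subtype.val (e.symm_apply_apply _)⟩
  · rintro ⟨w, rfl⟩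
    exact (e.symm w).2

/-! ### The condition number -/

/-- Block matrices of mixed systems are nonsingular when the homogeneous system has only the
trivial solution. -/
lemma det_ne_zero_of_mixedSystem {H : Type*} [AddCommGroup H] [Module ℝ H]
    {α π μ : H →ₗ[ℝ] H →ₗ[ℝ] ℝ} {ε σ : ℝ}
    (h0 : ∀ x, MixedSystem α π μ ⊤ 0 (ε, σ) x → x = 0) {N : ℕ}
    (φ ψ : Module.Basis (Fin N) ℝ H) :
    (Matrix.fromBlocks
      (Matrix.of fun i j => α (φ j) (φ i))
      (Matrix.of fun i j => (1 - ε) * π (ψ j) (φ i))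
      (Matrix.of fun i j => π (φ j) (ψ i))
      (Matrix.of fun i j => -(ε * π (ψ j) (ψ i)) - σ * μ (ψ j) (ψ i))).det ≠ 0 := by
  intro hdet
  obtain ⟨z, hz0, hz⟩ := Matrix.exists_mulVec_eq_zero_iff.2 hdet
  refine hz0 ?_
  have hsum : ∀ (β : H →ₗ[ℝ] H →ₗ[ℝ] ℝ) (χ : Module.Basis (Fin N) ℝ H) (c : Fin N → ℝ) v,
      β (χ.equivFun.symm c) v = ∑ j, β (χ j) v * c j := fun β χ c v => by
    simp [Module.Basis.equivFun_symm_apply, mul_comm]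
  set u := φ.equivFun.symm fun j => z (Sum.inl j) with hu
  set ξ := ψ.equivFun.symm fun j => z (Sum.inr j) with hξ
  -- Row `i` of `M z = 0` is the homogeneous equation tested with the `i`-th basis vector, the
  -- halves of `z` being the coefficients of `u` and `ξ`.
  have e1 : α u + (1 - ε) • π ξ = 0 := by
    refine φ.ext fun i => ?_
    have := congrFun hz (Sum.inl i)
    simp only [Matrix.mulVec, dotProduct, Fintype.sum_sum_type,
      Matrix.fromBlocks_apply₁₁, Matrix.fromBlocks_apply₁₂, Matrix.of_apply, Pi.zero_apply,
      mul_assoc, ← Finset.mul_sum] at this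
    simpa only [hu, hξ, LinearMap.add_apply, LinearMap.smul_apply, LinearMap.zero_apply,
      smul_eq_mul, hsum] using this
  have e2 : π u - ε • π ξ - σ • μ ξ = 0 := by
    refine ψ.ext fun i => ?_
    have := congrFun hz (Sum.inr i)
    simp only [Matrix.mulVec, dotProduct, Fintype.sum_sum_type,
      Matrix.fromBlocks_apply₂₁, Matrix.fromBlocks_apply₂₂, Matrix.of_apply, Pi.zero_apply,
      sub_mul, neg_mul, mul_assoc, Finset.sum_sub_distrib,
      Finset.sum_neg_distrib, ← Finset.mul_sum] at this
    simp only [hu, hξ, LinearMap.sub_apply, LinearMap.smul_apply, LinearMap.zero_apply,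
      smul_eq_mul, hsum]
    linarith
  have hx : ((u, ξ) : H × H) = 0 := by
    refine h0 _ ⟨trivial, fun v => ?_, fun w _ => ?_⟩
    · simpa using LinearMap.congr_fun e1 v
    · simpa using LinearMap.congr_fun e2 w
  rw [Prod.mk_eq_zero, hu, hξ, LinearEquiv.map_eq_zero_iff, LinearEquiv.map_eq_zero_iff] at hx
  funext i
  rcases i with i | i
  · exact congrFun hx.1 i
  · exact congrFun hx.2 i

lemma isUnit_det_systemMatrix (hd : d ≠ 0) (hP : P.HypothesisA) {Vh : Submodule ℝ P.V} {N : ℕ}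
    (φ ψ : Module.Basis (Fin N) ℝ Vh) {ε σ : ℝ} (hε : 0 ≤ ε) (hσ : 0 < σ) :
    IsUnit (systemMatrix φ ψ ε σ).det := by
  let e := φ.equivFun
  have hinj : Function.Injective (Vh.subtype ∘ₗ e.symm.toLinearMap) :=
    Subtype.val_injective.comp e.symm.injective
  obtain ⟨α, π, μ, h⟩ := exists_represents hP hinj
  have := det_ne_zero_of_mixedSystem (α := α) (π := π) (μ := μ) (ε := ε) (σ := σ)
    (fun x hx => h.eq_zero_of_mixedSystem_top hd hP ⟨hε, hσ⟩ hx) (φ.map e) (ψ.map e)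
  simp only [h.apply_a, h.apply_aPar, h.apply_l2, LinearMap.comp_apply, LinearEquiv.coe_coe,
    Module.Basis.map_apply, LinearEquiv.symm_apply_apply, Submodule.subtype_apply] at this
  exact isUnit_iff_ne_zero.2 this

lemma continuous_systemMatrix {Vh : Submodule ℝ P.V} {N : ℕ}
    (φ ψ : Module.Basis (Fin N) ℝ Vh) (σ : ℝ) :
    Continuous fun ε => systemMatrix φ ψ ε σ := by
  refine Continuous.matrix_fromBlocks continuous_const ?_ continuous_const ?_
  · exact continuous_matrix fun i j => by simp only [Matrix.of_apply]; fun_prop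
  · exact continuous_matrix fun i j => by simp only [Matrix.of_apply]; fun_prop

end Problem

end AnisoAP

/-! ### Assembly of the four assertions -/

theorem mainTheorem11 :
    ∃ β : ℝ, 0 < β ∧
      ∀ (d : ℕ), d = 2 ∨ d = 3 → ∀ (P : AnisoAP.Problem d), P.HypothesisA →
      ∀ (Vh : Submodule ℝ P.V), FiniteDimensional ℝ Vh →
        (∀ f : P.V →ₗ[ℝ] ℝ, AnisoAP.Problem.InDual f →
          ∃ U : ℝ → ℝ → P.V × P.V,
            (∀ ε : ℝ, 0 ≤ ε → ∀ σ : ℝ, 0 < σ →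
              (∀ x : P.V × P.V, AnisoAP.Problem.SolvesScheme f Vh ε σ x ↔ x = U ε σ) ∧
              (U ε σ).2 ∈ AnisoAP.Problem.Ah Vh) ∧
            (∀ ε ∈ Set.Icc (0 : ℝ) 1, ∀ σ : ℝ, 0 < σ →
              AnisoAP.Problem.normX Vh ε σ (U ε σ) ≤ 1 / β * AnisoAP.Problem.dualNorm f) ∧
            (∀ ε : ℝ, 0 ≤ ε → ∀ x : P.V × P.V,
              AnisoAP.Problem.SolvesReduced f Vh ε 0 x ↔ x = U ε 0) ∧
            (∀ ε : ℝ, 0 ≤ ε →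
              Filter.Tendsto (fun σ => U ε σ) (nhdsWithin 0 (Set.Ioi 0)) (nhds (U ε 0))) ∧
            Filter.Tendsto (fun ε => U ε 0) (nhdsWithin 0 (Set.Ioi 0)) (nhds (U 0 0))) ∧
        (∀ (N : ℕ) (φ ψ : Module.Basis (Fin N) ℝ Vh) (σ : ℝ), 0 < σ →
          ∃ C : ℝ, ∀ ε ∈ Set.Icc (0 : ℝ) 1,
            IsUnit (AnisoAP.Problem.systemMatrix φ ψ ε σ).det ∧
            AnisoAP.cond2 (AnisoAP.Problem.systemMatrix φ ψ ε σ) ≤ C) := by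
  -- `β = 1/5` is the inverse of the constant in `normX_le`.
  refine ⟨1 / 5, by norm_num, fun d hd P hP Vh _ => ⟨fun f hf => ?_, fun N φ ψ σ hσ => ?_⟩⟩
  · have hd0 : d ≠ 0 := by omega
    obtain ⟨U, hU, hV⟩ := AnisoAP.Problem.exists_solution_family hd0 hP Vh f
    refine ⟨fun ε σ => U (ε, σ), fun ε hε σ hσ => ⟨hU ε σ hε hσ, ?_⟩, fun ε hε σ hσ => ?_,
      fun ε hε => (hV ε 0 hε le_rfl).1, fun ε hε => ?_, ?_⟩
    · exact (((hV ε σ hε hσ.le).1 _).2 rfl).2.1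
    · have := AnisoAP.Problem.normX_le hP hf hε hσ.le ((hU ε σ hε.1 hσ _).2 rfl)
      simpa using this
    -- Both limits restrict the joint continuity of `U` on the closed quadrant to a coordinate line.
    · have hc : ContinuousAt (fun σ : ℝ => U (ε, σ)) 0 :=
        (hV ε 0 hε le_rfl).2.comp (f := fun σ : ℝ => (ε, σ)) (by fun_prop)
      exact hc.tendsto.mono_left nhdsWithin_le_nhds
    · have hc : ContinuousAt (fun ε : ℝ => U (ε, 0)) 0 :=
        (hV 0 0 le_rfl le_rfl).2.comp (f := fun ε : ℝ => (ε, 0)) (by fun_prop)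
      exact hc.tendsto.mono_left nhdsWithin_le_nhds
  · have hd0 : d ≠ 0 := by omega
    have hdet : ∀ ε ∈ Set.Icc (0 : ℝ) 1,
        IsUnit (AnisoAP.Problem.systemMatrix φ ψ ε σ).det := fun ε hε =>
      AnisoAP.Problem.isUnit_det_systemMatrix hd0 hP φ ψ hε.1 hσ
    obtain ⟨C, hC⟩ := AnisoAP.exists_cond2_le
      (AnisoAP.Problem.continuous_systemMatrix φ ψ σ) isCompact_Icc hdet
    exact ⟨C, fun ε hε => ⟨hdet ε hε, hC ε hε⟩⟩
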